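/- Let $m$ be Lebesgue measure on $\mathbf R$ and let $s:\mathbf R\to\mathbf R$ be strictly increasing and (locally) absolutely continuous with $s'\in\{0,1\}$ a.e. Assume that $\{s'=1\}$ has an open a.e. version $G$, and put $F=\mathbf R\setminus G$; assume that $m(F)>0$, that $F$ has no isolated points, and that $m(G)=\infty$. Let $$\mathcal F_e=\{u: u\text{ absolutely continuous on }\mathbf R,\ u'\in L^2(\mathbf R)\},\qquad \mathcal E(u,v)=\tfrac12\int_{\mathbf R}u'v'\,dx,$$ $$\mathcal F^{(s)}=\Big\{u\in L^2(\mathbf R): u\ll s,\ \int\big(\tfrac{du}{ds}\big)^2ds<\infty\Big\},\qquad \mathcal E^{(s)}(u,v)=\tfrac12\int\tfrac{du}{ds}\tfrac{dv}{ds}\,ds,$$ let $\mathcal F^{(s)}_e$ be the extended Dirichlet space of $(\mathcal E^{(s)},\mathcal F^{(s)})$ (continuous versions of a.e. limits of $\mathcal E^{(s)}$-Cauchy sequences in $\mathcal F^{(s)}$), and let $$\mathcal G^{(s)}=\{u\in\mathcal F_e:\mathcal E(u,v)=0\text{ for all }v\in\mathcal F^{(s)}_e\},\qquad \mathcal G^{(s)}_0=\mathcal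 G^{(s)}\cap L^2(\mathbf R).$$ Let $z\in F$ not be an endpoint of a component of $G$, and define $j(x)=\int_z^x 1_F(t)\,dt$, $\mathbf R_j=j(\mathbf R)$ and $m_j=m\circ j^{-1}$. A *D-space* $(E,\xi,\mathcal D,\mathcal A)$ is a measure space $(E,\xi)$ with a Dirichlet form $(\mathcal A,\mathcal D)$ on $L^2(E,\xi)$ in the wide sense, i.e. having all properties of a Dirichlet form except possibly density of $\mathcal D$ in $L^2(E,\xi)$. Two D-spaces are *equivalent* if there is an algebra isomorphism from $\mathcal D\cap L^\infty$ onto $\mathcal D'\cap L^\infty$ that preserves $\|u\|_\infty$, $\mathcal A(u,u)$ and $(u,u)_\xi$. A Dirichlet form on $L^2(J,\nu)$, where $J$ is an interval and $\nu$ has infinite mass at each endpoint of $J$ that belongs to $J$ (so that the functions of $L^2(J,\nu)$ vanish there), is called *regular* if it is a regular Dirichlet form on $L^2(J^\circ,\nu|_{J^\circ})$, where $J^\circ$ is the interior of $J$. A *regular representation* of a D-space is an equivalent D-space whose form is a regular Dirichlet form. **Theorem 3.6.** 1. $j$ maps the closure of each component of $G$ to a single point. If moreover $m(F\cap(x-\varepsilon,x+\varepsilon))>0$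 for all $x\in F$ and $\varepsilon>0$, then $j(p)=j(q)$ with $p\ne q$ only if $p$ and $q$ lie in the closure of one component of $G$. 2. For each $u\in\mathcal G^{(s)}$ there is a unique function $\hat u$ on $\mathbf R_j$ with $\hat u\circ j=u$. The set $\mathcal G^{(s)}_j:=\{\hat u:u\in\mathcal G^{(s)}\}$ is $$\mathcal G^{(s)}_j=\{\hat u:\ \hat u\text{ is absolutely continuous on }\mathbf R_j\text{ and }\hat u'\in L^2(\mathbf R_j)\}$$ (absolute continuity being on compact subintervals, and $L^2(\mathbf R_j)$ being with respect to Lebesgue measure). 3. The form $\mathcal E_j(\hat u,\hat v):=\mathcal E(u,v)$ satisfies $$\mathcal E_j(\hat u,\hat v)=\frac12\int_{\mathbf R_j}\hat u'(x)\hat v'(x)\,dx,\qquad \hat u,\hat v\in\mathcal G^{(s)}_j.$$ 4. With $\mathcal G^{(s)}_{j,0}:=\mathcal G^{(s)}_j\cap L^2(\mathbf R_j,m_j)$, the form $(\mathcal E_j,\mathcal G^{(s)}_{j,0})$ is a regular Dirichlet form on $L^2(\mathbf R_j,m_j)$, and $(\mathbf R_j,m_j,\mathcal G^{(s)}_{j,0},\mathcal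 E_j)$ is a regular representation of the D-space $(\mathbf R,m,\mathcal G^{(s)}_0,\mathcal E)$. -/

import Mathlib

open MeasureTheory Set Filter
open scoped Topology ENNReal

noncomputable section

namespace Darning

/-! ### Absolute continuity, the extended Dirichlet space of Brownian motion -/

/-- `f` is absolutely continuous on the interval `J`, i.e. on each compact `[a, b] ⊆ J`. -/
def AbsContOn (J : Set ℝ) (f : ℝ → ℝ) : Prop :=
  ∀ a ∈ J, ∀ b ∈ J, AbsolutelyContinuousOnInterval f a b

/-- `H¹_e(ℝ)`: absolutely continuous functions with square integrable derivative. -/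
def Fe : Set (ℝ → ℝ) :=
  {u | AbsContOn univ u ∧ MemLp (deriv u) 2 volume}

/-- `ℰ(u, v) = ½ ∫ u' v'`. -/
def energy (u v : ℝ → ℝ) : ℝ := (1 / 2) * ∫ x, deriv u x * deriv v x

/-! ### The regular subspace with scaling function `s` -/

open Classical in
/-- The Lebesgue–Stieltjes measure `ds` of a monotone (continuous) function `s`. -/
def dsMeasure (s : ℝ → ℝ) : Measure ℝ :=
  if h : Monotone s then h.stieltjesFunction.measure else 0

/-- `u` is absolutely continuous with respect to `s`, with density `g = du/ds`. -/
def HasDensityWrt (s u g : ℝ → ℝ) : Prop :=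
  LocallyIntegrable g (dsMeasure s) ∧
    ∀ a b, a ≤ b → u b - u a = ∫ x in Ioc a b, g x ∂(dsMeasure s)

/-- `u ≪ s`. -/
def AbsContWrt (s u : ℝ → ℝ) : Prop := ∃ g, HasDensityWrt s u g

open Classical in
/-- `du/ds` (a version; it is unique `ds`-a.e.). -/
def scaleDeriv (s u : ℝ → ℝ) : ℝ → ℝ :=
  if h : AbsContWrt s u then h.choose else 0

/-- `ℱ^(s) = {u ∈ L²(ℝ) : u ≪ s, ∫ (du/ds)² ds < ∞}`. -/
def Fs (s : ℝ → ℝ) : Set (ℝ → ℝ) :=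
  {u | MemLp u 2 volume ∧ AbsContWrt s u ∧ MemLp (scaleDeriv s u) 2 (dsMeasure s)}

/-- `ℰ^(s)(u, v) = ½ ∫ (du/ds) (dv/ds) ds`. -/
def energyS (s u v : ℝ → ℝ) : ℝ :=
  (1 / 2) * ∫ x, scaleDeriv s u x * scaleDeriv s v x ∂(dsMeasure s)

/-- The extended Dirichlet space `ℱ^(s)_e` of `(ℰ^(s), ℱ^(s))`: the a.e. limits of `ℰ^(s)`-Cauchy
sequences in `ℱ^(s)`, each represented by its continuous version. -/
def Fse (s : ℝ → ℝ) : Set (ℝ → ℝ) :=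
  {u | Continuous u ∧ ∃ w : ℕ → ℝ → ℝ, (∀ n, w n ∈ Fs s) ∧
    (∀ ε > 0, ∃ N, ∀ m ≥ N, ∀ n ≥ N, energyS s (w m - w n) (w m - w n) < ε) ∧
    ∀ᵐ x, Tendsto (fun n => w n x) atTop (𝓝 (u x))}

/-- `𝒢^(s)`: the `ℰ`-orthogonal complement of `ℱ^(s)_e` in `ℱ_e`. -/
def Gs (s : ℝ → ℝ) : Set (ℝ → ℝ) :=
  {u | u ∈ Fe ∧ ∀ v ∈ Fse s, energy u v = 0}

/-! ### The darning map -/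

/-- The finite endpoints of the components of the open set `G ⊆ ℝ`. -/
def endpoints (G : Set ℝ) : Set ℝ :=
  {p | ∃ x ∈ G, p ∈ frontier (connectedComponentIn G x)}

/-- `j(x) = ∫_z^x 1_F(t) dt`. -/
def darn (F : Set ℝ) (z x : ℝ) : ℝ := ∫ t in z..x, F.indicator (fun _ => (1 : ℝ)) t

/-- `ℝ_j = j(ℝ)`. -/
abbrev Rj (F : Set ℝ) (z : ℝ) : Set ℝ := range (darn F z)

/-- `j` as a map `ℝ → ℝ_j`. -/
def darnTo (F : Set ℝ) (z : ℝ) : ℝ → Rj F z := rangeFactorization (darn F z)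

/-- `m_j = m ∘ j⁻¹`, a measure on `ℝ_j`. -/
def mj (F : Set ℝ) (z : ℝ) : Measure (Rj F z) := Measure.map (darnTo F z) volume

/-- A function on an interval `J`, extended by zero to `ℝ`. -/
def ext0 {J : Set ℝ} (f : J → ℝ) : ℝ → ℝ := Function.extend Subtype.val f 0

/-- `𝒢^(s)_j = {û : û ∘ j = u for some u ∈ 𝒢^(s)}`. -/
def Gsj (s : ℝ → ℝ) (F : Set ℝ) (z : ℝ) : Set (Rj F z → ℝ) :=
  {w | ∃ u ∈ Gs s, w ∘ darnTo F z = u}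

/-- `ℰ_j(û, v̂) = ℰ(u, v)` with `u = û ∘ j`, `v = v̂ ∘ j`. -/
def energyJ (F : Set ℝ) (z : ℝ) (f g : Rj F z → ℝ) : ℝ :=
  energy (f ∘ darnTo F z) (g ∘ darnTo F z)

/-! ### Dirichlet forms, D-spaces, regular representations -/

/-- A form on `L²(E, ξ)` with its domain; `form` is only used on `dom`. -/
structure L2Form {E : Type*} [MeasurableSpace E] (ξ : Measure E) where
  dom : Set (Lp ℝ 2 ξ)
  form : Lp ℝ 2 ξ → Lp ℝ 2 ξ → ℝ

namespace L2Form

variable {E : Type*} [MeasurableSpace E] {ξ : Measure E}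

open Classical in
/-- The form on `L²(E, ξ)` whose domain is `V ∩ L²(E, ξ)`, with value `B` on
representatives from `V`. -/
def ofFunctions (ξ : Measure E) (V : Set (E → ℝ)) (B : (E → ℝ) → (E → ℝ) → ℝ) : L2Form ξ where
  dom := {f | ∃ u ∈ V, f =ᵐ[ξ] u}
  form f g :=
    if h : (∃ u ∈ V, f =ᵐ[ξ] u) ∧ (∃ v ∈ V, g =ᵐ[ξ] v) then B h.1.choose h.2.choose else 0

/-- `ℰ₁(f, f) = ℰ(f, f) + (f, f)_ξ`. -/
def sq1 (D : L2Form ξ) (f : Lp ℝ 2 ξ) : ℝ := D.form f f + ‖f‖ ^ 2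

/-- D-space, or Dirichlet form in the wide sense: a closed symmetric nonnegative bilinear form
with the Markov property, whose domain need not be dense. -/
structure IsDSpace (D : L2Form ξ) : Prop where
  zero_mem : 0 ∈ D.dom
  add_mem : ∀ f ∈ D.dom, ∀ g ∈ D.dom, f + g ∈ D.dom
  smul_mem : ∀ (c : ℝ), ∀ f ∈ D.dom, c • f ∈ D.dom
  symm : ∀ f ∈ D.dom, ∀ g ∈ D.dom, D.form f g = D.form g f
  add_left : ∀ f ∈ D.dom, ∀ g ∈ D.dom, ∀ h ∈ D.dom,
    D.form (f + g) h = D.form f h + D.form g h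
  smul_left : ∀ (c : ℝ), ∀ f ∈ D.dom, ∀ g ∈ D.dom, D.form (c • f) g = c * D.form f g
  nonneg : ∀ f ∈ D.dom, 0 ≤ D.form f f
  closed : ∀ f : ℕ → Lp ℝ 2 ξ, (∀ n, f n ∈ D.dom) →
    (∀ ε > 0, ∃ N, ∀ m ≥ N, ∀ n ≥ N, D.sq1 (f m - f n) < ε) →
    ∃ g ∈ D.dom, Tendsto (fun n => D.sq1 (f n - g)) atTop (𝓝 0)
  markov : ∀ (φ : ℝ → ℝ) (hφ : LipschitzWith 1 φ) (h0 : φ 0 = 0), ∀ f ∈ D.dom,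
    hφ.compLp h0 f ∈ D.dom ∧ D.form (hφ.compLp h0 f) (hφ.compLp h0 f) ≤ D.form f f

/-- Regular Dirichlet form on `L²(E, ξ)`: `E` is a locally compact separable metrizable space, `ξ`
a Radon measure with full support, the form is a D-space with dense domain, and the (classes of)
functions of the domain in `C_c(E)` are `ℰ₁`-dense in the domain and uniformly dense in `C_c(E)`. -/
structure IsRegularDirichlet [TopologicalSpace E] [BorelSpace E] (D : L2Form ξ) : Prop where
  locallyCompact : LocallyCompactSpace E
  separable : TopologicalSpace.SeparableSpace E
  metrizable : TopologicalSpace.MetrizableSpace E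
  radon : IsFiniteMeasureOnCompacts ξ
  fullSupport : ξ.IsOpenPosMeasure
  isDSpace : D.IsDSpace
  dense : Dense D.dom
  dense_dom : ∀ f ∈ D.dom, ∀ ε > 0, ∃ g ∈ D.dom,
    (∃ ψ : E → ℝ, Continuous ψ ∧ HasCompactSupport ψ ∧ g =ᵐ[ξ] ψ) ∧ D.sq1 (f - g) < ε
  dense_Cc : ∀ φ : E → ℝ, Continuous φ → HasCompactSupport φ → ∀ ε > 0, ∃ g ∈ D.dom,
    ∃ ψ : E → ℝ, Continuous ψ ∧ HasCompactSupport ψ ∧ g =ᵐ[ξ] ψ ∧ ∀ x, |φ x - ψ x| < ε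

/-- `ℱ ∩ L^∞`. -/
def bdd (D : L2Form ξ) : Set (Lp ℝ 2 ξ) := {f | f ∈ D.dom ∧ MemLp f ∞ ξ}

/-- Equivalence of D-spaces: an algebra isomorphism `ℱ ∩ L^∞ → ℱ' ∩ L^∞` preserving the sup-norm,
the form and the `L²` inner product. -/
def Equivalent {E' : Type*} [MeasurableSpace E'] {ξ' : Measure E'}
    (D : L2Form ξ) (D' : L2Form ξ') : Prop :=
  D.IsDSpace ∧ D'.IsDSpace ∧
  ∃ Φ : Lp ℝ 2 ξ → Lp ℝ 2 ξ', BijOn Φ D.bdd D'.bdd ∧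
    (∀ f ∈ D.bdd, ∀ g ∈ D.bdd, Φ (f + g) = Φ f + Φ g) ∧
    (∀ (c : ℝ), ∀ f ∈ D.bdd, Φ (c • f) = c • Φ f) ∧
    (∀ f ∈ D.bdd, ∀ g ∈ D.bdd, ∃ h ∈ D.bdd,
      h =ᵐ[ξ] (fun x => f x * g x) ∧ Φ h =ᵐ[ξ'] (fun x => Φ f x * Φ g x)) ∧
    ∀ f ∈ D.bdd, eLpNorm f ∞ ξ = eLpNorm (Φ f) ∞ ξ' ∧
      D.form f f = D'.form (Φ f) (Φ f) ∧ inner ℝ f f = inner ℝ (Φ f) (Φ f)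

theorem memLp_extend {U : Set E} (hU : MeasurableSet U)
    (f : Lp ℝ 2 (ξ.comap (Subtype.val : U → E))) :
    MemLp (Function.extend Subtype.val f 0 : E → ℝ) 2 ξ := by
  have he : Function.extend Subtype.val f 0 =
      U.indicator (Function.extend (Subtype.val : U → E) f 0) := by
    ext x
    by_cases hx : x ∈ U
    · simp [hx]
    · rw [Set.indicator_of_notMem hx, Function.extend_apply']
      · rfl
      · rintro ⟨y, rfl⟩
        exact hx y.2
  rw [he, memLp_indicator_iff_restrict hU, ← map_comap_subtype_coe hU,
    (MeasurableEmbedding.subtype_coe hU).memLp_map_measure_iff,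
    Function.extend_comp Subtype.val_injective]
  exact Lp.memLp f

/-- Extension by zero `L²(U, ξ|_U) → L²(E, ξ)`. -/
def zeroExt {U : Set E} (hU : MeasurableSet U)
    (f : Lp ℝ 2 (ξ.comap (Subtype.val : U → E))) : Lp ℝ 2 ξ :=
  (memLp_extend hU f).toLp _

/-- The form on `L²(U, ξ|_U)` given by the functions of `dom` that vanish off `U`. -/
def restrictTo (D : L2Form ξ) {U : Set E} (hU : MeasurableSet U) :
    L2Form (ξ.comap (Subtype.val : U → E)) where
  dom := {f | zeroExt hU f ∈ D.dom}
  form f g := D.form (zeroExt hU f) (zeroExt hU g)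

end L2Form

/-- The interior of the interval `J`, as a subset of the space `J`. -/
def interiorIn (J : Set ℝ) : Set J := {x | (x : ℝ) ∈ interior J}

theorem measurableSet_interiorIn (J : Set ℝ) : MeasurableSet (interiorIn J) :=
  (isOpen_interior.preimage continuous_subtype_val).measurableSet

/-- Regular Dirichlet form on `L²(J, ν)` for an interval `J` and a measure `ν` with infinite mass at
each endpoint of `J` that belongs to `J`. Functions in `L²(J, ν)` then vanish at these endpoints,
and regularity means regularity on `L²(J°, ν|_{J°})`, where `J°` is the interior of `J`. For open
`J` this is the usual notion. -/
def IsRegularDirichletOnInterval {J : Set ℝ} {ν : Measure J} (D : L2Form ν) : Prop :=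
  J.OrdConnected ∧ (∀ x ∉ interiorIn J, ν {x} = ∞) ∧ D.IsDSpace ∧
    (D.restrictTo (measurableSet_interiorIn J)).IsRegularDirichlet

/-- `D'`, on an interval, is a regular representation of the D-space `D`. -/
def IsRegularRepresentation {E : Type*} [MeasurableSpace E] {ξ : Measure E} {J : Set ℝ}
    {ν : Measure J} (D : L2Form ξ) (D' : L2Form ν) : Prop :=
  D.Equivalent D' ∧ IsRegularDirichletOnInterval D'

/-- The D-space `(ℝ, m, 𝒢^(s)_0, ℰ)`, where `𝒢^(s)_0 = 𝒢^(s) ∩ L²(ℝ)`. -/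
def formG0 (s : ℝ → ℝ) : L2Form (volume : Measure ℝ) :=
  L2Form.ofFunctions volume (Gs s) energy

/-- `(ℝ_j, m_j, 𝒢^(s)_{j,0}, ℰ_j)`, where `𝒢^(s)_{j,0} = 𝒢^(s)_j ∩ L²(ℝ_j, m_j)`. -/
def formGj0 (s : ℝ → ℝ) (F : Set ℝ) (z : ℝ) : L2Form (mj F z) :=
  L2Form.ofFunctions (mj F z) (Gsj s F z) (energyJ F z)

end Darning

end

/-! ### Primitives and absolute continuity on intervals. -/

noncomputable section

namespace Darning

/-! Since `s` is absolutely continuous with `s' = 1_G` a.e., the measure `ds` is Lebesgue measure on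
`G`. Hence an energy-Cauchy sequence has derivatives converging in L²(G), and every `v` in `Fse s`
has `v' = 0` a.e. off `G`. Conversely, the primitive of a compactly supported L² function living on
`G` with mean zero lies in `Fse s`; the mean must vanish so that the primitive has compact support
and is itself in L². Because `G` has infinite measure this constraint disappears in the limit: a
mean `|A|` can be compensated by a multiple of the indicator of a huge piece of `G`, at arbitrarily
small L² cost. So `u ∈ Fe` is orthogonal to `Fse s` exactly when `u' = 0` a.e. on `G`
(`mem_Gs_iff`), that is, `Gs s = flatOff F`.

The map `j` is the primitive of `1_F`, so it carries Lebesgue measure on `F` to Lebesgue measure on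
`ℝ_j` (`map_darn`). A function that is flat off `F` is constant on the fibres of `j`, hence factors
as `û ∘ j`, and the change of variables gives `u' = 1_F · (û' ∘ j)`; this turns `Fe` and the energy
on ℝ into their analogues on `ℝ_j` (`comp_darn_mem_flatOff_iff`, `energy_comp_darn`).

The measure `m_j` is the image of the whole Lebesgue measure, so composition with `j` is an isometry
from L²(m_j) into L²(ℝ) whose range contains the domain of the form. The D-space axioms are checked
once on ℝ (`isDSpace_flatForm`) and pulled back, and the same isometry gives the equivalence.

For regularity, an endpoint belonging to `ℝ_j` has a half-line in its fibre, hence infinite mass,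
and L² functions vanish there. On the interior, smooth functions of compact support give density in
C_c and in L². Density of the core in the form norm comes from soft thresholding: a function in L²
with derivative in L² tends to 0 at infinity, so cutting off the values in `[-δ, δ]` produces
compact support, and the part removed tends to 0 in the form norm (`exists_sq1_sub_soft_lt`,
`hasCompactSupport_soft`). -/

/-- On the interval `J`, `f` is an indefinite integral of `g`. -/
def IsPrimitiveOn (J : Set ℝ) (f g : ℝ → ℝ) : Prop :=
  ∀ a ∈ J, ∀ b ∈ J, IntervalIntegrable g volume a b ∧ ∫ x in a..b, g x = f b - f a

theorem absolutelyContinuousOnInterval_congr {f g : ℝ → ℝ} {a b : ℝ}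
    (hf : AbsolutelyContinuousOnInterval f a b) (h : EqOn f g (uIcc a b)) :
    AbsolutelyContinuousOnInterval g a b := by
  rw [absolutelyContinuousOnInterval_iff] at hf ⊢
  intro ε hε
  obtain ⟨δ, hδ, H⟩ := hf ε hε
  refine ⟨δ, hδ, fun E hE hlt => ?_⟩
  have := H E hE hlt
  convert this using 1
  refine Finset.sum_congr rfl fun i hi => ?_
  rw [h (hE.1 i hi).1, h (hE.1 i hi).2]

theorem AbsContOn.isPrimitiveOn {J : Set ℝ} {f : ℝ → ℝ} (hf : AbsContOn J f) :
    IsPrimitiveOn J f (deriv f) := fun a ha b hb =>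
  ⟨(hf a ha b hb).intervalIntegrable_deriv, (hf a ha b hb).integral_deriv_eq_sub⟩

theorem IsPrimitiveOn.absContOn {J : Set ℝ} (hJ : J.OrdConnected) {f g : ℝ → ℝ}
    (h : IsPrimitiveOn J f g) : AbsContOn J f := by
  intro a ha b hb
  have h1 := (h a ha b hb).1.absolutelyContinuousOnInterval_intervalIntegral (c := a) left_mem_uIcc
  have h2 : AbsolutelyContinuousOnInterval (fun _ : ℝ => f a) a b :=
    (LipschitzWith.const (f a)).lipschitzOnWith.absolutelyContinuousOnInterval (K := 0)
  refine absolutelyContinuousOnInterval_congr (h1.add h2) fun x hx => ?_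
  have hx' : x ∈ J := hJ.uIcc_subset ha hb hx
  simp [(h a ha x hx').2]

theorem IsPrimitiveOn.ae_hasDerivAt {J : Set ℝ} (hJ : J.OrdConnected) {f g : ℝ → ℝ}
    (h : IsPrimitiveOn J f g) : ∀ᵐ x ∂(volume.restrict J), HasDerivAt f (g x) x := by
  -- `f` is uncontrolled outside `J`, so a two-sided derivative is available only strictly between
  -- two points of `J`; such open intervals exhaust `J` up to its endpoints.
  refine ae_restrict_of_ae_restrict_inter_Ioo fun a b ha hb hab => ?_
  have h1 := (h a ha b hb).1.ae_hasDerivAt_integral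
  rw [ae_restrict_iff' (hJ.measurableSet.inter measurableSet_Ioo)]
  filter_upwards [h1] with x hx hxJ
  have h2 := (hx (by rw [uIcc_of_le hab.le]; exact Ioo_subset_Icc_self hxJ.2) a left_mem_uIcc).add_const (f a)
  refine h2.congr_of_eventuallyEq ?_
  filter_upwards [Ioo_mem_nhds hxJ.2.1 hxJ.2.2] with y hy
  have hy' : y ∈ J := hJ.out ha hb (Ioo_subset_Icc_self hy)
  simp [(h a ha y hy').2]

theorem IsPrimitiveOn.deriv_ae_eq {J : Set ℝ} (hJ : J.OrdConnected) {f g : ℝ → ℝ}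
    (h : IsPrimitiveOn J f g) : deriv f =ᵐ[volume.restrict J] g :=
  (h.ae_hasDerivAt hJ).mono fun _ hx => hx.deriv

theorem AbsContOn.ae_hasDerivAt {J : Set ℝ} (hJ : J.OrdConnected) {f : ℝ → ℝ}
    (h : AbsContOn J f) : ∀ᵐ x ∂(volume.restrict J), HasDerivAt f (deriv f x) x :=
  h.isPrimitiveOn.ae_hasDerivAt hJ

theorem AbsContOn.continuousOn {J : Set ℝ} {f : ℝ → ℝ}
    (h : AbsContOn J f) : ContinuousOn f J := by
  intro x hx
  by_cases h1 : ∃ a ∈ J, a < x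
  · by_cases h2 : ∃ b ∈ J, x < b
    · obtain ⟨a, ha, hax⟩ := h1
      obtain ⟨b, hb, hxb⟩ := h2
      refine (((h a ha b hb).continuousOn).continuousAt ?_).continuousWithinAt
      rw [uIcc_of_le (hax.trans hxb).le]
      exact Icc_mem_nhds hax hxb
    · push Not at h2
      obtain ⟨a, ha, hax⟩ := h1
      have h3 := (h a ha x hx).continuousOn x right_mem_uIcc
      rw [uIcc_of_le hax.le] at h3
      refine (h3.mono_of_mem_nhdsWithin ?_)
      filter_upwards [self_mem_nhdsWithin, mem_nhdsWithin_of_mem_nhds (Ioi_mem_nhds hax)] with y hy hy'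
      exact ⟨le_of_lt hy', h2 y hy⟩
  · push Not at h1
    by_cases h2 : ∃ b ∈ J, x < b
    · obtain ⟨b, hb, hxb⟩ := h2
      have h3 := (h x hx b hb).continuousOn x left_mem_uIcc
      rw [uIcc_of_le hxb.le] at h3
      refine (h3.mono_of_mem_nhdsWithin ?_)
      filter_upwards [self_mem_nhdsWithin, mem_nhdsWithin_of_mem_nhds (Iio_mem_nhds hxb)] with y hy hy'
      exact ⟨h1 y hy, le_of_lt hy'⟩
    · push Not at h2
      have : J ⊆ {x} := fun y hy => le_antisymm (h2 y hy) (h1 y hy)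
      exact (continuousWithinAt_singleton).mono this

theorem AbsContOn.continuous {f : ℝ → ℝ} (h : AbsContOn univ f) : Continuous f :=
  continuousOn_univ.1 h.continuousOn

theorem AbsContOn.ae_hasDerivAt_univ {f : ℝ → ℝ} (h : AbsContOn univ f) :
    ∀ᵐ x, HasDerivAt f (deriv f x) x := by
  simpa using h.ae_hasDerivAt ordConnected_univ

theorem isPrimitiveOn_of_le {J : Set ℝ} {f g : ℝ → ℝ}
    (h : ∀ a ∈ J, ∀ b ∈ J, a ≤ b → IntegrableOn g (Ioc a b) volume ∧
      ∫ x in Ioc a b, g x = f b - f a) : IsPrimitiveOn J f g := by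
  intro a ha b hb
  rcases le_total a b with hab | hab
  · obtain ⟨h1, h2⟩ := h a ha b hb hab
    exact ⟨(intervalIntegrable_iff_integrableOn_Ioc_of_le hab).2 h1,
      by rw [intervalIntegral.integral_of_le hab, h2]⟩
  · obtain ⟨h1, h2⟩ := h b hb a ha hab
    refine ⟨((intervalIntegrable_iff_integrableOn_Ioc_of_le hab).2 h1).symm, ?_⟩
    rw [intervalIntegral.integral_of_ge hab, h2, neg_sub]

/-- The zeros of `f` at which the derivative does not vanish form a null set. -/
theorem ae_deriv_eq_zero_of_eq_zero {f : ℝ → ℝ} (c : ℝ) : ∀ᵐ x, f x = c → deriv f x = 0 := by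
  have hc : {x | f x = c ∧ deriv f x ≠ 0}.Countable := by
    -- A nonzero derivative keeps `f` away from `c` in a punctured neighbourhood, so `S` is
    -- discrete, and a discrete subset of ℝ is countable.
    set S := {x | f x = c ∧ deriv f x ≠ 0} with hS
    have : DiscreteTopology S := by
      rw [discreteTopology_subtype_iff]
      intro x hx
      have hd : HasDerivAt f (deriv f x) x :=
        (differentiableAt_of_deriv_ne_zero hx.2).hasDerivAt
      have h1 := hd.eventually_ne (c := c) hx.2
      rw [← disjoint_iff, disjoint_principal_right]
      filter_upwards [h1] with y hy hyS
      exact hy hyS.1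
    exact countable_coe_iff.1 (countable_of_Lindelof_of_discrete)
  have := hc.measure_zero volume
  rw [measure_eq_zero_iff_ae_notMem] at this
  filter_upwards [this] with x hx hfx
  by_contra h
  exact hx ⟨hfx, h⟩

end Darning

end

/-! ### The orthogonal complement: functions whose derivative vanishes on `G`. -/

noncomputable section

namespace Darning

variable {s : ℝ → ℝ} {G : Set ℝ}

/-- The two measures agree on each `(a, b]`, because `s b - s a` is the integral of `s'`, and `s'`
equals `1_G` almost everywhere. -/
theorem dsMeasure_eq_restrict (hs : Monotone s) (hac : AbsContOn univ s)
    (hderiv : ∀ᵐ x, deriv s x = 0 ∨ deriv s x = 1) (hGm : MeasurableSet G)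
    (hG : G =ᵐ[volume] {x | deriv s x = 1}) : dsMeasure s = volume.restrict G := by
  have hc := hac.continuous
  have hst : ∀ x, hs.stieltjesFunction x = s x := fun x => by
    rw [hs.stieltjesFunction_eq]
    exact hc.continuousAt.continuousWithinAt.rightLim_eq
  have hd : deriv s =ᵐ[volume] G.indicator 1 := by
    filter_upwards [hderiv, hG] with x hx hx'
    have hx' : (x ∈ G) = (deriv s x = 1) := hx'
    by_cases h : x ∈ G
    · simp [h, hx'.mp h]
    · have : ¬ deriv s x = 1 := fun h1 => h (hx'.mpr h1)
      simp [h, hx.resolve_right this]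
  rw [dsMeasure, dif_pos hs]
  refine Measure.ext_of_Ioc _ _ fun a b hab => ?_
  rw [StieltjesFunction.measure_Ioc, hst, hst,
    ← (hac a (mem_univ _) b (mem_univ _)).integral_deriv_eq_sub,
    intervalIntegral.integral_congr_ae (hd.mono fun x hx _ => hx),
    intervalIntegral.integral_of_le hab.le, integral_indicator_one hGm,
    measureReal_def, ENNReal.ofReal_toReal (ne_of_lt ?_), Measure.restrict_apply hGm,
    Measure.restrict_apply measurableSet_Ioc, inter_comm]
  rw [Measure.restrict_apply hGm]
  exact (measure_mono inter_subset_right).trans_lt (by simp)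

theorem locallyIntegrable_restrict_iff (hGm : MeasurableSet G) {g : ℝ → ℝ} :
    LocallyIntegrable g (volume.restrict G) ↔ LocallyIntegrable (G.indicator g) volume := by
  rw [locallyIntegrable_iff, locallyIntegrable_iff]
  refine forall_congr' fun K => forall_congr' fun hK => ?_
  rw [IntegrableOn, Measure.restrict_restrict hK.measurableSet, IntegrableOn,
    integrable_indicator_iff hGm, IntegrableOn, Measure.restrict_restrict hGm, inter_comm]

/-- Reduces calculus with respect to `s` to ordinary calculus: a density `g` with respect to `ds =
1_G dx` is an ordinary derivative `1_G g`. -/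
theorem hasDensityWrt_iff (hds : dsMeasure s = volume.restrict G) (hGm : MeasurableSet G)
    {u g : ℝ → ℝ} : HasDensityWrt s u g ↔
      LocallyIntegrable (G.indicator g) volume ∧ IsPrimitiveOn univ u (G.indicator g) := by
  have key : ∀ a b, ∫ x in Ioc a b, g x ∂(dsMeasure s) = ∫ x in Ioc a b, G.indicator g x := by
    intro a b
    rw [hds, Measure.restrict_restrict measurableSet_Ioc, setIntegral_indicator hGm]
  rw [HasDensityWrt, hds, locallyIntegrable_restrict_iff hGm, ← hds]
  refine and_congr_right fun hl => ⟨fun h => isPrimitiveOn_of_le fun a _ b _ hab =>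
    ⟨(hl.integrableOn_isCompact isCompact_Icc).mono_set Ioc_subset_Icc_self, ?_⟩, fun h a b hab => ?_⟩
  · rw [h a b hab, key]
  · rw [← (h a (mem_univ _) b (mem_univ _)).2, key, intervalIntegral.integral_of_le hab]

theorem AbsContWrt.hasDensityWrt {u : ℝ → ℝ} (h : AbsContWrt s u) :
    HasDensityWrt s u (scaleDeriv s u) := by
  rw [scaleDeriv, dif_pos h]
  exact h.choose_spec

/-- Makes the arbitrary choice in `scaleDeriv` harmless: on `G`, any density is almost everywhere
the ordinary derivative of `u`. -/
theorem HasDensityWrt.ae_eq (hds : dsMeasure s = volume.restrict G) (hGm : MeasurableSet G)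
    {u g h : ℝ → ℝ} (hg : HasDensityWrt s u g) (hh : HasDensityWrt s u h) :
    g =ᵐ[volume.restrict G] h := by
  have h1 := ((hasDensityWrt_iff hds hGm).1 hg).2.deriv_ae_eq ordConnected_univ
  have h2 := ((hasDensityWrt_iff hds hGm).1 hh).2.deriv_ae_eq ordConnected_univ
  rw [Measure.restrict_univ] at h1 h2
  rw [Filter.EventuallyEq, ae_restrict_iff' hGm]
  filter_upwards [h1.symm.trans h2] with x hx hxG
  simpa [hxG] using hx

theorem HasDensityWrt.sub {u v g h : ℝ → ℝ} (hg : HasDensityWrt s u g)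
    (hh : HasDensityWrt s v h) [IsLocallyFiniteMeasure (dsMeasure s)] :
    HasDensityWrt s (u - v) (g - h) := by
  refine ⟨hg.1.sub hh.1, fun a b hab => ?_⟩
  have hi : ∀ {f : ℝ → ℝ}, LocallyIntegrable f (dsMeasure s) →
      IntegrableOn f (Ioc a b) (dsMeasure s) := fun hf =>
    (hf.integrableOn_isCompact isCompact_Icc).mono_set Ioc_subset_Icc_self
  simp only [Pi.sub_apply]
  rw [integral_sub (hi hg.1) (hi hh.1), ← hg.2 a b hab, ← hh.2 a b hab]
  ring

theorem tendsto_setIntegral_of_tendsto_L2 {E : Type*} [MeasurableSpace E] {μ : Measure E}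
    {f : ℕ → Lp ℝ 2 μ} {g : Lp ℝ 2 μ} (h : Tendsto f atTop (𝓝 g)) {S : Set E}
    (hS : MeasurableSet S) (hS' : μ S ≠ ∞) :
    Tendsto (fun n => ∫ x in S, f n x ∂μ) atTop (𝓝 (∫ x in S, g x ∂μ)) := by
  have h1 := ((continuous_const (y := indicatorConstLp 2 hS hS' (1 : ℝ))).inner
    continuous_id (𝕜 := ℝ)).tendsto g |>.comp h
  simpa only [Function.comp_def, id, L2.inner_indicatorConstLp_one] using h1

/-- The energy is half the squared L²(G) distance of densities, so the densities of an approximating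
sequence converge to some `g` in L²(G). Their integrals over bounded intervals converge too, which
exhibits `v` as a primitive of `1_G g`. -/
theorem deriv_eq_zero_of_mem_Fse (hds : dsMeasure s = volume.restrict G) (hGm : MeasurableSet G)
    {v : ℝ → ℝ} (hv : v ∈ Fse s) : ∀ᵐ x, x ∉ G → deriv v x = 0 := by
  obtain ⟨hvc, w, hw, hcau, hlim⟩ := hv
  have : IsLocallyFiniteMeasure (dsMeasure s) := by rw [hds]; infer_instance
  have hden : ∀ n, HasDensityWrt s (w n) (scaleDeriv s (w n)) := fun n => (hw n).2.1.hasDensityWrt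
  have hL2 : ∀ n, MemLp (scaleDeriv s (w n)) 2 (volume.restrict G) := fun n => by
    rw [← hds]; exact (hw n).2.2
  set f : ℕ → Lp ℝ 2 (volume.restrict G) := fun n => (hL2 n).toLp _ with hf
  have hnorm : ∀ m n, energyS s (w m - w n) (w m - w n) = (1 / 2) * ‖f m - f n‖ ^ 2 := by
    intro m n
    have h1 := (AbsContWrt.hasDensityWrt ⟨_, (hden m).sub (hden n)⟩).ae_eq hds hGm
      ((hden m).sub (hden n))
    rw [energyS, hds, ← real_inner_self_eq_norm_sq, L2.inner_def]
    congr 1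
    refine integral_congr_ae ?_
    filter_upwards [h1, Lp.coeFn_sub (f m) (f n), (hL2 m).coeFn_toLp, (hL2 n).coeFn_toLp]
      with x h1 h2 h3 h4
    rw [h1, h2]
    simp [hf, h3, h4, sq]
  have hC : CauchySeq f := by
    rw [Metric.cauchySeq_iff]
    intro ε hε
    obtain ⟨N, hN⟩ := hcau (1 / 2 * ε ^ 2) (by positivity)
    refine ⟨N, fun m hm n hn => ?_⟩
    have := hN m hm n hn
    rw [hnorm] at this
    rw [dist_eq_norm]
    exact lt_of_pow_lt_pow_left₀ 2 hε.le (by linarith)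
  obtain ⟨g, hg⟩ := cauchySeq_tendsto_of_complete hC
  have hloc : LocallyIntegrable (G.indicator g) volume :=
    (locallyIntegrable_restrict_iff hGm).1 ((Lp.memLp g).locallyIntegrable (by norm_num))
  have hii : ∀ a b, IntervalIntegrable (G.indicator g) volume a b := fun a b =>
    ⟨(hloc.integrableOn_isCompact isCompact_Icc).mono_set Ioc_subset_Icc_self,
      (hloc.integrableOn_isCompact isCompact_Icc).mono_set Ioc_subset_Icc_self⟩
  have hset : ∀ a b, Tendsto (fun n => ∫ x in Ioc a b, scaleDeriv s (w n) x ∂(volume.restrict G))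
      atTop (𝓝 (∫ x in Ioc a b, G.indicator g x)) := by
    intro a b
    have hfin : (volume.restrict G) (Ioc a b) ≠ ∞ :=
      ne_of_lt ((Measure.restrict_apply_le _ _).trans_lt (by simp))
    have h1 := tendsto_setIntegral_of_tendsto_L2 hg measurableSet_Ioc hfin
    rw [setIntegral_indicator hGm, ← Measure.restrict_restrict measurableSet_Ioc]
    refine h1.congr fun n => integral_congr_ae ?_
    exact ae_restrict_of_ae (hL2 n).coeFn_toLp
  have hle : ∀ a b, a ≤ b → Tendsto (fun n => w n a) atTop (𝓝 (v a)) →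
      Tendsto (fun n => w n b) atTop (𝓝 (v b)) → ∫ x in Ioc a b, G.indicator g x = v b - v a := by
    intro a b hab ha hb
    refine tendsto_nhds_unique (hset a b) ((hb.sub ha).congr fun n => ?_)
    rw [(hden n).2 a b hab, hds]
  obtain ⟨x₀, hx₀⟩ := hlim.exists
  -- Pointwise convergence is known only almost everywhere; continuity of both sides extends the
  -- identity to all `x`.
  have hprim : ∀ x, v x = v x₀ + ∫ t in x₀..x, G.indicator g t := by
    have hcont : Continuous fun x => v x₀ + ∫ t in x₀..x, G.indicator g t :=
      continuous_const.add (intervalIntegral.continuous_primitive hii x₀)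
    refine fun x => congrFun ((hvc.ae_eq_iff_eq volume hcont).1 ?_) x
    filter_upwards [hlim] with x hx
    rcases le_total x₀ x with h | h
    · rw [intervalIntegral.integral_of_le h, hle _ _ h hx₀ hx]; ring
    · rw [intervalIntegral.integral_of_ge h, hle _ _ h hx hx₀]; ring
  have hP : IsPrimitiveOn univ v (G.indicator g) := fun a _ b _ => ⟨hii a b, by
    rw [hprim b, hprim a, add_sub_add_left_eq_sub, intervalIntegral.integral_interval_sub_left
      (hii _ _) (hii _ _)]⟩
  have h2 := hP.deriv_ae_eq ordConnected_univ
  rw [Measure.restrict_univ] at h2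
  filter_upwards [h2] with x hx hxG
  rw [hx, indicator_of_notMem hxG]

/-- Primitives of bounded, compactly supported functions on `G` with mean zero lie in `ℱ^(s)_e`. -/
theorem exists_mem_Fse (hds : dsMeasure s = volume.restrict G) (hGm : MeasurableSet G)
    {g : ℝ → ℝ} {R : ℝ} (hg : MemLp g 2 volume) (hg0 : ∀ x, x ∉ G → g x = 0)
    (hgR : ∀ x, x ∉ Ioc (-R) R → g x = 0) (hgi : ∫ x, g x = 0) :
    ∃ v ∈ Fse s, deriv v =ᵐ[volume] g := by
  have hind : G.indicator g = g := indicator_eq_self.2 fun x hx => by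
    by_contra h
    exact hx (hg0 x h)
  have hloc : LocallyIntegrable g volume := hg.locallyIntegrable (by norm_num)
  have hii : ∀ a b, IntervalIntegrable g volume a b := fun a b =>
    ⟨(hloc.integrableOn_isCompact isCompact_Icc).mono_set Ioc_subset_Icc_self,
      (hloc.integrableOn_isCompact isCompact_Icc).mono_set Ioc_subset_Icc_self⟩
  set v : ℝ → ℝ := fun x => ∫ t in (-R)..x, g t with hv
  have hP : IsPrimitiveOn univ v g := fun a _ b _ => ⟨hii a b,
    (intervalIntegral.integral_interval_sub_left (hii _ _) (hii _ _)).symm⟩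
  have hvc : Continuous v := intervalIntegral.continuous_primitive hii _
  -- The primitive starts from 0 at `-R`, and the vanishing mean brings it back to 0 beyond `R`.
  have hsupp : HasCompactSupport v := by
    refine HasCompactSupport.intro (isCompact_Icc (a := -R) (b := R)) fun x hx => ?_
    rcases lt_or_ge x (-R) with h | h
    · refine intervalIntegral.integral_zero_ae (Eventually.of_forall fun t ht => hgR t fun ht' => ?_)
      rw [uIoc_of_ge h.le] at ht
      exact absurd ht.2 (not_le.2 ht'.1)
    · have h' : R < x := by
        by_contra h'
        exact hx ⟨h, not_lt.1 h'⟩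
      simp only [hv]
      rw [intervalIntegral.integral_of_le h, ← hgi,
        setIntegral_eq_integral_of_forall_compl_eq_zero]
      intro t ht
      exact hgR t fun ht' => ht ⟨ht'.1, ht'.2.trans h'.le⟩
  have hden : HasDensityWrt s v g := (hasDensityWrt_iff hds hGm).2 (by rw [hind]; exact ⟨hloc, hP⟩)
  have hvFs : v ∈ Fs s := by
    refine ⟨hvc.memLp_of_hasCompactSupport hsupp, ⟨g, hden⟩, ?_⟩
    rw [hds]
    refine (memLp_congr_ae ((AbsContWrt.hasDensityWrt ⟨g, hden⟩).ae_eq hds hGm hden)).2 ?_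
    exact hg.restrict G
  have h0 : energyS s 0 0 = 0 := by
    have hz : HasDensityWrt s 0 0 := ⟨locallyIntegrable_zero, by simp⟩
    rw [energyS, hds, integral_eq_zero_of_ae, mul_zero]
    filter_upwards [(AbsContWrt.hasDensityWrt ⟨0, hz⟩).ae_eq hds hGm hz] with x hx
    simp [hx]
  -- As `v` already lies in `Fs s`, the constant sequence is an approximating one.
  refine ⟨v, ⟨hvc, fun _ => v, fun _ => hvFs, fun ε hε => ⟨0, fun m _ n _ => ?_⟩,
    Eventually.of_forall fun x => tendsto_const_nhds⟩, ?_⟩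
  · rw [sub_self, h0]; exact hε
  · simpa using hP.deriv_ae_eq ordConnected_univ

theorem integrableOn_of_memLp_two {h : ℝ → ℝ} {A : Set ℝ} (hh : MemLp h 2 volume)
    (hA : volume A ≠ ∞) : IntegrableOn h A volume := by
  have : IsFiniteMeasure (volume.restrict A) := ⟨by simpa using hA.lt_top⟩
  exact (hh.restrict A).integrable (by norm_num)

/-- Test functions have mean-zero derivative, so orthogonality alone would only give that `h` is
constant on `G`; infinite measure forces that constant to be 0. Concretely, for `A` in a bounded
piece of `G` one compensates `1_A` by a multiple of `1_{B N}`, where `B N` is the part of `G` in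
`(-N, N]`, and lets `N` tend to infinity. -/
theorem ae_eq_zero_of_orthogonal (hds : dsMeasure s = volume.restrict G) (hGm : MeasurableSet G)
    (hGinf : volume G = ∞) {h : ℝ → ℝ} (hh : MemLp h 2 volume)
    (horth : ∀ v ∈ Fse s, ∫ x, h x * deriv v x = 0) : ∀ᵐ x, x ∈ G → h x = 0 := by
  set U := hh.toLp h with hU
  have hcoe := hh.coeFn_toLp
  have hint : ∀ {S : Set ℝ} (hS : MeasurableSet S) (hS' : volume S ≠ ∞),
      ∫ x in S, h x = inner ℝ (indicatorConstLp 2 hS hS' (1 : ℝ)) U := fun hS hS' => by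
    rw [L2.inner_indicatorConstLp_one]
    exact integral_congr_ae (ae_restrict_of_ae hcoe.symm)
  set B : ℕ → Set ℝ := fun n => G ∩ Ioc (-(n : ℝ)) n with hB
  have hBm : ∀ n, MeasurableSet (B n) := fun n => hGm.inter measurableSet_Ioc
  have hBfin : ∀ n, volume (B n) ≠ ∞ := fun n =>
    ne_of_lt ((measure_mono inter_subset_right).trans_lt (by simp))
  have hBmono : Monotone B := fun m n hmn => inter_subset_inter_right _
    (Ioc_subset_Ioc (by simpa using hmn) (by simpa using hmn))
  have hBU : ⋃ n, B n = G := by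
    rw [← inter_iUnion, inter_eq_left]
    intro x _
    obtain ⟨n, hn⟩ := exists_nat_gt |x|
    exact mem_iUnion.2 ⟨n, (abs_lt.1 hn).1, (abs_lt.1 hn).2.le⟩
  have hBtend : Tendsto (fun n => volume (B n)) atTop (𝓝 ∞) := by
    have := tendsto_measure_iUnion_atTop (μ := volume) hBmono
    rwa [hBU, hGinf] at this
  have hBreal : Tendsto (fun n => volume.real (B n)) atTop atTop := by
    rw [tendsto_atTop]
    intro M
    have := hBtend.eventually (lt_mem_nhds (ENNReal.ofReal_lt_top (r := M)))
    filter_upwards [this] with n hn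
    exact (ENNReal.ofReal_le_iff_le_toReal (hBfin n)).1 hn.le
  have key : ∀ n, ∀ A, MeasurableSet A → A ⊆ B n → ∫ x in A, h x = 0 := by
    intro n A hA hAn
    have hAfin : volume A ≠ ∞ := ne_of_lt ((measure_mono hAn).trans_lt (hBfin n).lt_top)
    have hbound : ∀ᶠ N in atTop, ‖∫ x in A, h x‖ ≤
        volume.real A * ‖U‖ * (Real.sqrt (volume.real (B N)))⁻¹ := by
      filter_upwards [hBreal.eventually_gt_atTop 0, eventually_ge_atTop n] with N hN hnN
      -- The factor that gives `1_A - c 1_{B N}` mean zero.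
      set c := volume.real A / volume.real (B N) with hc
      have hA2 : MemLp (A.indicator fun _ => (1 : ℝ)) 2 volume :=
        memLp_indicator_const 2 hA 1 (Or.inr hAfin)
      have hB2 : MemLp ((B N).indicator fun _ => (1 : ℝ)) 2 volume :=
        memLp_indicator_const 2 (hBm N) 1 (Or.inr (hBfin N))
      have hAi : Integrable (A.indicator fun _ => (1 : ℝ)) volume :=
        (integrable_indicator_iff hA).2 (integrableOn_const hAfin)
      have hBi : Integrable ((B N).indicator fun _ => (1 : ℝ)) volume :=
        (integrable_indicator_iff (hBm N)).2 (integrableOn_const (hBfin N))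
      obtain ⟨v, hv, hdv⟩ := exists_mem_Fse hds hGm (R := N)
        (g := (A.indicator fun _ => (1 : ℝ)) - c • (B N).indicator fun _ => (1 : ℝ))
        (hA2.sub (hB2.const_smul c))
        (fun x hx => by
          have h1 : x ∉ A := fun h => hx (hAn h).1
          have h2 : x ∉ B N := fun h => hx h.1
          simp [h1, h2])
        (fun x hx => by
          have h1 : x ∉ A := fun h => hx (hBmono hnN (hAn h)).2
          have h2 : x ∉ B N := fun h => hx h.2
          simp [h1, h2])
        (by
          simp only [Pi.sub_apply, Pi.smul_apply, smul_eq_mul]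
          rw [integral_sub hAi (hBi.const_mul c), integral_const_mul, integral_indicator_const _ hA,
            integral_indicator_const _ (hBm N), hc]
          simp only [smul_eq_mul, mul_one]
          field_simp
          ring)
      have h1 := horth v hv
      have h2 : ∫ x, h x * deriv v x = (∫ x in A, h x) - c * ∫ x in B N, h x := by
        have hhA : Integrable (A.indicator h) volume :=
          (integrable_indicator_iff hA).2 (integrableOn_of_memLp_two hh hAfin)
        have hhB : Integrable ((B N).indicator h) volume :=
          (integrable_indicator_iff (hBm N)).2 (integrableOn_of_memLp_two hh (hBfin N))
        rw [← integral_indicator hA, ← integral_indicator (hBm N), ← integral_const_mul,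
          ← integral_sub hhA (hhB.const_mul c)]
        refine integral_congr_ae ?_
        filter_upwards [hdv] with x hx
        rw [hx]
        by_cases hxA : x ∈ A <;> by_cases hxB : x ∈ B N <;> simp [hxA, hxB] <;> ring
      have h3 : ∫ x in A, h x = c * ∫ x in B N, h x := by linarith
      rw [h3, hint (hBm N) (hBfin N), norm_mul]
      -- By Cauchy–Schwarz the correction is at most `c √|B N| ‖h‖ = |A| ‖h‖ / √|B N|`, which tends
      -- to 0.
      have h4 := norm_inner_le_norm (𝕜 := ℝ) (indicatorConstLp 2 (hBm N) (hBfin N) (1 : ℝ)) U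
      rw [norm_indicatorConstLp (by norm_num) (by norm_num)] at h4
      simp only [norm_one, one_mul, ENNReal.toReal_ofNat, ← Real.sqrt_eq_rpow] at h4
      have hc0 : ‖c‖ = c := by rw [Real.norm_eq_abs, abs_of_nonneg]; positivity
      rw [hc0]
      calc _ ≤ c * (Real.sqrt (volume.real (B N)) * ‖U‖) := by gcongr
        _ = _ := by
          rw [hc]
          have h5 : Real.sqrt (volume.real (B N)) ≠ 0 := (Real.sqrt_pos.2 hN).ne'
          nth_rewrite 1 [← Real.mul_self_sqrt hN.le]
          field_simp
    have hlim : Tendsto (fun N => volume.real A * ‖U‖ * (Real.sqrt (volume.real (B N)))⁻¹)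
        atTop (𝓝 (volume.real A * ‖U‖ * 0)) :=
      (tendsto_inv_atTop_zero.comp (Real.tendsto_sqrt_atTop.comp hBreal)).const_mul _
    rw [mul_zero] at hlim
    exact norm_le_zero_iff.1 (ge_of_tendsto hlim hbound)
  have hall : ∀ n, ∀ᵐ x, x ∈ B n → h x = 0 := by
    intro n
    rw [← ae_restrict_iff' (hBm n)]
    have : IsFiniteMeasure (volume.restrict (B n)) := ⟨by simpa using (hBfin n).lt_top⟩
    refine ae_eq_zero_of_forall_setIntegral_eq_of_sigmaFinite (fun S hS _ => ?_) fun S hS _ => ?_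
    · exact ((hh.restrict (B n)).integrable (by norm_num)).integrableOn
    · rw [Measure.restrict_restrict hS]
      exact key n _ (hS.inter (hBm n)) inter_subset_right
  filter_upwards [ae_all_iff.2 hall] with x hx hxG
  rw [← hBU] at hxG
  obtain ⟨n, hn⟩ := mem_iUnion.1 hxG
  exact hx n hn

/-- One direction is `ae_eq_zero_of_orthogonal`; in the other, `u'` vanishes on `G` and `v'` off
`G`, so the integrand of the energy is zero. -/
theorem mem_Gs_iff (hds : dsMeasure s = volume.restrict G) (hGm : MeasurableSet G)
    (hGinf : volume G = ∞) {u : ℝ → ℝ} :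
    u ∈ Gs s ↔ u ∈ Fe ∧ ∀ᵐ x, x ∈ G → deriv u x = 0 := by
  refine and_congr_right fun hu => ⟨fun h => ?_, fun h v hv => ?_⟩
  · exact ae_eq_zero_of_orthogonal hds hGm hGinf hu.2 fun v hv => by simpa [energy] using h v hv
  · rw [energy, integral_eq_zero_of_ae, mul_zero]
    filter_upwards [h, deriv_eq_zero_of_mem_Fse hds hGm hv] with x h1 h2
    by_cases hx : x ∈ G
    · simp [h1 hx]
    · simp [h2 hx]

end Darning

end

/-! ### The darning map and the change of variables. -/

noncomputable section

namespace Darning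

/-- Functions in `H¹_e(ℝ)` whose derivative vanishes almost everywhere off `F`. -/
def flatOff (F : Set ℝ) : Set (ℝ → ℝ) := {u | u ∈ Fe ∧ ∀ᵐ x, x ∉ F → deriv u x = 0}

variable {F : Set ℝ} {z : ℝ}

theorem intervalIntegrable_indicator_one (hF : MeasurableSet F) (a b : ℝ) :
    IntervalIntegrable (F.indicator fun _ => (1 : ℝ)) volume a b :=
  ⟨(integrableOn_const (by simp)).indicator hF, (integrableOn_const (by simp)).indicator hF⟩

theorem darn_sub (hF : MeasurableSet F) (a b : ℝ) :
    darn F z b - darn F z a = ∫ t in a..b, F.indicator (fun _ => (1 : ℝ)) t :=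
  intervalIntegral.integral_interval_sub_left (intervalIntegrable_indicator_one hF _ _)
    (intervalIntegrable_indicator_one hF _ _)

theorem darn_sub_of_le (hF : MeasurableSet F) {a b : ℝ} (hab : a ≤ b) :
    darn F z b - darn F z a = volume.real (F ∩ Ioc a b) := by
  rw [darn_sub hF, intervalIntegral.integral_of_le hab, setIntegral_indicator hF,
    setIntegral_const, smul_eq_mul, mul_one, inter_comm]

theorem volume_inter_Ioc_ne_top (a b : ℝ) : volume (F ∩ Ioc a b) ≠ ∞ :=
  ne_of_lt ((measure_mono inter_subset_right).trans_lt (by simp))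

theorem volume_inter_Ioc (hF : MeasurableSet F) {a b : ℝ} (hab : a ≤ b) :
    volume (F ∩ Ioc a b) = ENNReal.ofReal (darn F z b - darn F z a) := by
  rw [darn_sub_of_le hF hab, measureReal_def, ENNReal.ofReal_toReal (volume_inter_Ioc_ne_top a b)]

theorem darn_eq_iff (hF : MeasurableSet F) {a b : ℝ} (hab : a ≤ b) :
    darn F z a = darn F z b ↔ volume (F ∩ Ioo a b) = 0 := by
  have h1 : volume (F ∩ Ioo a b) = volume (F ∩ Ioc a b) :=
    measure_congr ((ae_eq_refl F).inter Ioo_ae_eq_Ioc)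
  rw [h1, eq_comm, ← sub_eq_zero, darn_sub_of_le hF hab, measureReal_def,
    ENNReal.toReal_eq_zero_iff, or_iff_left (volume_inter_Ioc_ne_top a b)]

theorem monotone_darn (hF : MeasurableSet F) : Monotone (darn F z) := fun a b hab => by
  rw [← sub_nonneg, darn_sub_of_le hF hab]
  exact measureReal_nonneg

theorem continuous_darn (hF : MeasurableSet F) : Continuous (darn F z) :=
  intervalIntegral.continuous_primitive (intervalIntegrable_indicator_one hF) z

theorem ordConnected_Rj (hF : MeasurableSet F) : (Rj F z).OrdConnected :=
  (isPreconnected_range (continuous_darn hF)).ordConnected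

/-- Between two points of one fibre there is no mass of `F`, and such open intervals cover the fibre
up to a null set. -/
theorem fiber_null (hF : MeasurableSet F) (c : ℝ) :
    volume.restrict F (darn F z ⁻¹' {c}) = 0 := by
  have hm : MeasurableSet (darn F z ⁻¹' {c}) :=
    (continuous_darn hF).measurable (measurableSet_singleton c)
  have : ∀ᵐ x ∂(volume.restrict (darn F z ⁻¹' {c})), x ∉ F := by
    refine ae_restrict_of_ae_restrict_inter_Ioo fun a b ha hb hab => ?_
    have h0 : volume (F ∩ Ioo a b) = 0 :=
      (darn_eq_iff hF hab.le).1 ((mem_singleton_iff.1 ha).trans (mem_singleton_iff.1 hb).symm)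
    rw [ae_restrict_iff' (hm.inter measurableSet_Ioo)]
    filter_upwards [measure_eq_zero_iff_ae_notMem.1 h0] with x hx hx' hxF
    exact hx ⟨hxF, hx'.2⟩
  rw [ae_restrict_iff' hm] at this
  rw [Measure.restrict_apply hm, measure_eq_zero_iff_ae_notMem]
  filter_upwards [this] with x hx hx'
  exact hx hx'.1 hx'.2

theorem ae_darn_ne (hF : MeasurableSet F) (c : ℝ) : ∀ᵐ x, x ∈ F → darn F z x ≠ c := by
  rw [← ae_restrict_iff' hF]
  exact measure_eq_zero_iff_ae_notMem.1 (fiber_null hF c)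

/-- By monotonicity the two sets can differ only on the fibres through `x` and `y`, which are null
in `F`. -/
theorem preimage_Ioc_ae_eq (hF : MeasurableSet F) {x y : ℝ} :
    (darn F z ⁻¹' Ioc (darn F z x) (darn F z y) : Set ℝ) =ᵐ[volume.restrict F] Ioc x y := by
  have h := monotone_darn (z := z) hF
  refine eventuallyEq_set.2 ((ae_restrict_iff' hF).2 ?_)
  filter_upwards [ae_darn_ne (z := z) hF (darn F z x), ae_darn_ne (z := z) hF (darn F z y)]
    with t h1 h2 ht
  refine ⟨fun ⟨h3, h4⟩ => ⟨h.reflect_lt h3, ?_⟩, fun ⟨h3, h4⟩ => ⟨?_, h h4⟩⟩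
  · exact (h.reflect_lt (lt_of_le_of_ne h4 (h2 ht))).le
  · exact lt_of_le_of_ne (h h3.le) (h1 ht).symm

theorem map_darn_Ioc (hF : MeasurableSet F) {a b : ℝ} (ha : a ∈ Rj F z) (hb : b ∈ Rj F z)
    (hab : a < b) : Measure.map (darn F z) (volume.restrict F) (Ioc a b) =
      volume.restrict (Rj F z) (Ioc a b) := by
  obtain ⟨x, rfl⟩ := ha
  obtain ⟨y, rfl⟩ := hb
  have hxy : x ≤ y := ((monotone_darn hF).reflect_lt hab).le
  rw [Measure.map_apply (continuous_darn hF).measurable measurableSet_Ioc,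
    measure_congr (preimage_Ioc_ae_eq hF), Measure.restrict_apply measurableSet_Ioc, inter_comm,
    volume_inter_Ioc hF hxy, Measure.restrict_apply measurableSet_Ioc, inter_eq_left.2,
    Real.volume_Ioc]
  exact Ioc_subset_Icc_self.trans ((ordConnected_Rj hF).out ⟨x, rfl⟩ ⟨y, rfl⟩)

/-- The image under `j` of Lebesgue measure on `F` is Lebesgue measure on `ℝ_j`. -/
theorem map_darn (hF : MeasurableSet F) :
    Measure.map (darn F z) (volume.restrict F) = volume.restrict (Rj F z) := by
  set μ := Measure.map (darn F z) (volume.restrict F) with hμ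
  have hJ := monotone_darn (z := z) hF
  have hR := ordConnected_Rj (z := z) hF
  have hm := (continuous_darn (z := z) hF).measurable
  -- Intersecting with `T n` moves the ends of a test interval into `ℝ_j`, where `map_darn_Ioc`
  -- applies.
  set T : ℕ → Set ℝ := fun n => Ioc (darn F z (-n)) (darn F z n) with hT
  have hloc : ∀ n, μ.restrict (T n) = (volume.restrict (Rj F z)).restrict (T n) := by
    intro n
    symm
    refine Measure.ext_of_Ioc _ _ fun a b _ => ?_
    rw [Measure.restrict_apply measurableSet_Ioc, Measure.restrict_apply measurableSet_Ioc,
      hT, Ioc_inter_Ioc]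
    have hle : darn F z (-n) ≤ darn F z n := hJ (by simp)
    rcases lt_or_ge (max a (darn F z (-n))) (min b (darn F z n)) with h | h
    · have h1 : max a (darn F z (-n)) ∈ Rj F z := hR.out ⟨-n, rfl⟩ ⟨n, rfl⟩
        ⟨le_max_right _ _, h.le.trans (min_le_right _ _)⟩
      have h2 : min b (darn F z n) ∈ Rj F z := hR.out ⟨-n, rfl⟩ ⟨n, rfl⟩
        ⟨(le_max_right _ _).trans h.le, min_le_right _ _⟩
      exact (map_darn_Ioc hF h1 h2 h).symm
    · simp [Ioc_eq_empty (not_lt.2 h)]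
  have hU := Measure.restrict_iUnion_congr.2 hloc
  -- The half-open sets `T n` can miss only a minimum of `ℝ_j`. That point is negligible for both
  -- measures: for the image measure because fibres are null in `F`, for Lebesgue measure trivially.
  have hsub : (Rj F z \ ⋃ n, T n).Subsingleton := by
    rintro _ ⟨⟨p, rfl⟩, hp⟩ _ ⟨⟨q, rfl⟩, hq⟩
    obtain ⟨n, hn⟩ := exists_nat_gt (max |p| |q|)
    have key : ∀ r : ℝ, |r| < n → darn F z r ∉ ⋃ n, T n → darn F z r = darn F z (-n) := by
      intro r hr hr'
      have h1 : darn F z r ≤ darn F z n := hJ (abs_lt.1 hr).2.le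
      refine le_antisymm ?_ (hJ (abs_lt.1 hr).1.le)
      by_contra h
      exact hr' (mem_iUnion.2 ⟨n, not_le.1 h, h1⟩)
    rw [key p ((le_max_left _ _).trans_lt hn) hp, key q ((le_max_right _ _).trans_lt hn) hq]
  have hTm : MeasurableSet (⋃ n, T n) := MeasurableSet.iUnion fun n => measurableSet_Ioc
  have h1 : ∀ᵐ x ∂μ, x ∈ ⋃ n, T n := by
    refine (ae_map_iff hm.aemeasurable (p := fun y => y ∈ ⋃ n, T n) hTm).2 ?_
    rcases hsub.eq_empty_or_singleton with h | ⟨c, hc⟩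
    · refine Eventually.of_forall fun x => ?_
      by_contra hx
      exact (h.subset ⟨⟨x, rfl⟩, hx⟩ : _)
    · rw [ae_restrict_iff' hF]
      filter_upwards [ae_darn_ne (z := z) hF c] with x hx hxF
      by_contra hx'
      exact hx hxF (hc.subset ⟨⟨x, rfl⟩, hx'⟩)
  have h2 : ∀ᵐ x ∂(volume.restrict (Rj F z)), x ∈ ⋃ n, T n := by
    rw [ae_restrict_iff' hR.measurableSet]
    filter_upwards [measure_eq_zero_iff_ae_notMem.1 (hsub.measure_zero volume)] with x hx hx'
    by_contra h
    exact hx ⟨hx', h⟩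
  rwa [Measure.restrict_eq_self_of_ae_mem h1, Measure.restrict_eq_self_of_ae_mem h2] at hU

theorem memLp_indicator_comp_darn (hF : MeasurableSet F) {g : ℝ → ℝ}
    (hg : AEStronglyMeasurable g (volume.restrict (Rj F z))) {p : ℝ≥0∞} :
    MemLp (F.indicator (g ∘ darn F z)) p volume ↔ MemLp g p (volume.restrict (Rj F z)) := by
  rw [memLp_indicator_iff_restrict hF, ← map_darn hF, memLp_map_measure_iff (by rwa [map_darn hF])
    (continuous_darn hF).measurable.aemeasurable]

theorem integral_indicator_comp_darn (hF : MeasurableSet F) {g : ℝ → ℝ}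
    (hg : AEStronglyMeasurable g (volume.restrict (Rj F z))) :
    ∫ x, F.indicator (g ∘ darn F z) x = ∫ x in Rj F z, g x := by
  rw [integral_indicator hF, ← map_darn hF, integral_map
    (continuous_darn hF).measurable.aemeasurable (by rwa [map_darn hF])]
  rfl

theorem restrict_Ioc_darn (hF : MeasurableSet F) (x y : ℝ) :
    volume.restrict (Ioc (darn F z x) (darn F z y)) =
      Measure.map (darn F z) ((volume.restrict F).restrict (Ioc x y)) := by
  rw [← Measure.restrict_congr_set (preimage_Ioc_ae_eq (z := z) hF),
    ← Measure.restrict_map (continuous_darn hF).measurable measurableSet_Ioc, map_darn hF,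
    Measure.restrict_restrict measurableSet_Ioc, inter_eq_left.2]
  exact Ioc_subset_Icc_self.trans ((ordConnected_Rj hF).out ⟨x, rfl⟩ ⟨y, rfl⟩)

theorem aestronglyMeasurable_map_Ioc (hF : MeasurableSet F) {g : ℝ → ℝ}
    (hg : AEStronglyMeasurable g (volume.restrict (Rj F z))) (x y : ℝ) :
    AEStronglyMeasurable g (Measure.map (darn F z) ((volume.restrict F).restrict (Ioc x y))) := by
  refine hg.mono_measure ?_
  rw [← map_darn hF]
  exact Measure.map_mono Measure.restrict_le_self (continuous_darn hF).measurable

theorem integrableOn_Ioc_darn (hF : MeasurableSet F) {g : ℝ → ℝ}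
    (hg : AEStronglyMeasurable g (volume.restrict (Rj F z))) (x y : ℝ) :
    IntegrableOn g (Ioc (darn F z x) (darn F z y)) volume ↔
      IntegrableOn (F.indicator (g ∘ darn F z)) (Ioc x y) volume := by
  rw [IntegrableOn, restrict_Ioc_darn hF, integrable_map_measure
    (aestronglyMeasurable_map_Ioc hF hg x y) (continuous_darn hF).measurable.aemeasurable,
    IntegrableOn, integrable_indicator_iff hF, IntegrableOn, Measure.restrict_restrict hF,
    Measure.restrict_restrict measurableSet_Ioc, inter_comm]

theorem setIntegral_Ioc_darn (hF : MeasurableSet F) {g : ℝ → ℝ}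
    (hg : AEStronglyMeasurable g (volume.restrict (Rj F z))) (x y : ℝ) :
    ∫ t in Ioc (darn F z x) (darn F z y), g t = ∫ t in Ioc x y, F.indicator (g ∘ darn F z) t := by
  rw [restrict_Ioc_darn hF, integral_map (continuous_darn hF).measurable.aemeasurable
    (aestronglyMeasurable_map_Ioc hF hg x y), setIntegral_indicator hF,
    Measure.restrict_restrict measurableSet_Ioc]
  rfl

/-- Any right inverse of a monotone map is monotone; this makes the arbitrarily chosen section of
`j` measurable. -/
theorem monotoneOn_invFun_darn (hF : MeasurableSet F) :
    MonotoneOn (Function.invFun (darn F z)) (Rj F z) := by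
  intro a ha b hb hab
  rcases hab.eq_or_lt with rfl | hlt
  · exact le_rfl
  · refine ((monotone_darn (z := z) hF).reflect_lt ?_).le
    rwa [Function.invFun_eq ha, Function.invFun_eq hb]

/-- A monotone map has only countably many values with more than one preimage. These form a Lebesgue
null set, so by `map_darn` their preimage is null in `F`. -/
theorem invFun_darn_ae (hF : MeasurableSet F) :
    ∀ᵐ x, x ∈ F → Function.invFun (darn F z) (darn F z x) = x := by
  have hD := (monotone_darn (z := z) hF).countable_setOfPred_two_preimages
  have h1 : Measure.map (darn F z) (volume.restrict F)
      {c | ∃ x y, x < y ∧ darn F z x = c ∧ darn F z y = c} = 0 := by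
    rw [map_darn hF]
    exact hD.measure_zero _
  rw [Measure.map_apply (continuous_darn hF).measurable hD.measurableSet,
    measure_eq_zero_iff_ae_notMem, ae_restrict_iff' hF] at h1
  filter_upwards [h1] with x hx hxF
  have h2 : darn F z (Function.invFun (darn F z) (darn F z x)) = darn F z x :=
    Function.invFun_eq ⟨x, rfl⟩
  by_contra hne
  rcases lt_or_gt_of_ne hne with h | h
  · exact hx hxF ⟨_, _, h, h2, rfl⟩
  · exact hx hxF ⟨_, _, h, rfl, h2⟩

theorem aestronglyMeasurable_comp_invFun (hF : MeasurableSet F) {g : ℝ → ℝ} (hg : Measurable g) :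
    AEStronglyMeasurable (g ∘ Function.invFun (darn F z)) (volume.restrict (Rj F z)) :=
  (hg.comp_aemeasurable (aemeasurable_restrict_of_monotoneOn (ordConnected_Rj hF).measurableSet
    (monotoneOn_invFun_darn hF))).aestronglyMeasurable

theorem indicator_comp_invFun_ae (hF : MeasurableSet F) {u : ℝ → ℝ} (hu : u ∈ flatOff F) :
    F.indicator ((deriv u ∘ Function.invFun (darn F z)) ∘ darn F z) =ᵐ[volume] deriv u := by
  filter_upwards [invFun_darn_ae (z := z) hF, hu.2] with x h1 h2
  by_cases hx : x ∈ F
  · simp [hx, h1 hx]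
  · simp [hx, h2 hx]

/-- The chain rule in integrated form: a change of variables under `j` shows that `f ∘ j` is a
primitive of `1_F · (f' ∘ j)`, and differentiating the primitive avoids any pointwise argument at
bad points of `j`. -/
theorem deriv_comp_darn_ae (hF : MeasurableSet F) {f : ℝ → ℝ} (hf : AbsContOn (Rj F z) f) :
    AbsContOn univ (f ∘ darn F z) ∧
      deriv (f ∘ darn F z) =ᵐ[volume] F.indicator (deriv f ∘ darn F z) := by
  have hP : IsPrimitiveOn univ (f ∘ darn F z) (F.indicator (deriv f ∘ darn F z)) := by
    refine isPrimitiveOn_of_le fun a _ b _ hab => ?_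
    have hJ := monotone_darn (z := z) hF hab
    obtain ⟨h1, h2⟩ := hf.isPrimitiveOn _ ⟨a, rfl⟩ _ ⟨b, rfl⟩
    rw [intervalIntegrable_iff_integrableOn_Ioc_of_le hJ] at h1
    rw [intervalIntegral.integral_of_le hJ] at h2
    have hm : AEStronglyMeasurable (deriv f) (volume.restrict (Rj F z)) :=
      (measurable_deriv f).aestronglyMeasurable
    exact ⟨(integrableOn_Ioc_darn hF hm a b).1 h1, by rw [← setIntegral_Ioc_darn hF hm, h2]; rfl⟩
  exact ⟨hP.absContOn ordConnected_univ, by simpa using hP.deriv_ae_eq ordConnected_univ⟩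

theorem comp_darn_mem_flatOff_iff (hF : MeasurableSet F) {f : ℝ → ℝ} :
    f ∘ darn F z ∈ flatOff F ↔
      AbsContOn (Rj F z) f ∧ MemLp (deriv f) 2 (volume.restrict (Rj F z)) := by
  have hR := ordConnected_Rj (z := z) hF
  constructor
  · intro hu
    -- The candidate for `f'`: the derivative upstairs read through the section of `j`, which
    -- inverts `j` almost everywhere on `F`.
    set g := deriv (f ∘ darn F z) ∘ Function.invFun (darn F z) with hg
    have hgm : AEStronglyMeasurable g (volume.restrict (Rj F z)) :=
      aestronglyMeasurable_comp_invFun hF (measurable_deriv _)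
    have hae := indicator_comp_invFun_ae (z := z) hF hu
    have hP : IsPrimitiveOn (Rj F z) f g := by
      refine isPrimitiveOn_of_le ?_
      rintro _ ⟨a, rfl⟩ _ ⟨b, rfl⟩ hab
      -- Equality of the images says nothing about the order of `a` and `b`, so it is treated apart.
      rcases hab.eq_or_lt with h | h
      · rw [h]; simp
      have hab' := ((monotone_darn hF).reflect_lt h).le
      rw [integrableOn_Ioc_darn hF hgm, setIntegral_Ioc_darn hF hgm]
      obtain ⟨h1, h2⟩ := hu.1.1.isPrimitiveOn a (mem_univ _) b (mem_univ _)
      rw [intervalIntegrable_iff_integrableOn_Ioc_of_le hab'] at h1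
      rw [intervalIntegral.integral_of_le hab'] at h2
      exact ⟨h1.congr (ae_restrict_of_ae hae.symm), by
        rw [integral_congr_ae (ae_restrict_of_ae hae), h2]; rfl⟩
    refine ⟨hP.absContOn hR, ?_⟩
    rw [memLp_congr_ae (hP.deriv_ae_eq hR), ← memLp_indicator_comp_darn hF hgm,
      memLp_congr_ae hae]
    exact hu.1.2
  · rintro ⟨h1, h2⟩
    obtain ⟨h3, h4⟩ := deriv_comp_darn_ae hF h1
    refine ⟨⟨h3, ?_⟩, ?_⟩
    · rwa [memLp_congr_ae h4, memLp_indicator_comp_darn hF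
        (measurable_deriv f).aestronglyMeasurable]
    · filter_upwards [h4] with x hx hxF
      simp [hx, hxF]

theorem energy_comp_darn (hF : MeasurableSet F) {f g : ℝ → ℝ} (hf : AbsContOn (Rj F z) f)
    (hg : AbsContOn (Rj F z) g) : energy (f ∘ darn F z) (g ∘ darn F z) =
      (1 / 2) * ∫ x in Rj F z, deriv f x * deriv g x := by
  have hm : AEStronglyMeasurable (fun x => deriv f x * deriv g x) (volume.restrict (Rj F z)) :=
    ((measurable_deriv f).mul (measurable_deriv g)).aestronglyMeasurable
  rw [energy, ← integral_indicator_comp_darn hF hm]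
  congr 1
  refine integral_congr_ae ?_
  filter_upwards [(deriv_comp_darn_ae hF hf).2, (deriv_comp_darn_ae hF hg).2] with x h1 h2
  rw [h1, h2]
  by_cases hx : x ∈ F <;> simp [hx]

theorem ext0_comp_darn (w : Rj F z → ℝ) : ext0 w ∘ darn F z = w ∘ darnTo F z := by
  ext x
  exact Subtype.val_injective.extend_apply w 0 (darnTo F z x)

/-- Between `x` and `y` almost every point is off `F`, where `u'` vanishes, so `u` does not change
there. -/
theorem eq_of_darn_eq (hF : MeasurableSet F) {u : ℝ → ℝ} (hu : u ∈ flatOff F) {x y : ℝ}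
    (h : darn F z x = darn F z y) : u x = u y := by
  wlog hxy : x ≤ y generalizing x y
  · exact (this h.symm (le_of_not_ge hxy)).symm
  have h1 := (hu.1.1.isPrimitiveOn x (mem_univ _) y (mem_univ _)).2
  rw [intervalIntegral.integral_of_le hxy, integral_eq_zero_of_ae] at h1
  · linarith
  · have h2 : volume (F ∩ Ioc x y) = 0 := by rw [volume_inter_Ioc (z := z) hF hxy, h]; simp
    rw [Filter.EventuallyEq, ae_restrict_iff' measurableSet_Ioc]
    filter_upwards [hu.2, measure_eq_zero_iff_ae_notMem.1 h2] with t h3 h4 h5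
    exact h3 fun h6 => h4 ⟨h6, h5⟩

theorem existsUnique_comp_darnTo (hF : MeasurableSet F) {u : ℝ → ℝ} (hu : u ∈ flatOff F) :
    ∃! w : Rj F z → ℝ, w ∘ darnTo F z = u := by
  refine ⟨fun r => u (Function.invFun (darn F z) r), ?_, fun w hw => ?_⟩
  · ext x
    exact eq_of_darn_eq hF hu (Function.invFun_eq (f := darn F z) ⟨x, rfl⟩)
  · refine (rangeFactorization_surjective (f := darn F z)).injective_comp_right ?_
    change w ∘ darnTo F z = _
    rw [hw]
    ext x
    exact (eq_of_darn_eq hF hu (Function.invFun_eq (f := darn F z) ⟨x, rfl⟩)).symm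

theorem Gsj_eq {s : ℝ → ℝ} (hF : MeasurableSet F) (hGs : Gs s = flatOff F) :
    Gsj s F z = {w | AbsContOn (Rj F z) (ext0 w) ∧
      MemLp (deriv (ext0 w)) 2 (volume.restrict (Rj F z))} := by
  ext w
  rw [mem_ofPred_eq, ← comp_darn_mem_flatOff_iff hF, ext0_comp_darn, Gsj, hGs]
  simp

/-- `C` is an interval, so the open interval between two points of its closure lies in `C` and
carries no mass of `F`. -/
theorem darn_eq_of_mem_closure (hF : MeasurableSet F) {C : Set ℝ} (hC : IsPreconnected C)
    (hCF : Disjoint C F) {p q : ℝ} (hp : p ∈ closure C) (hq : q ∈ closure C) :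
    darn F z p = darn F z q := by
  wlog hpq : p ≤ q generalizing p q
  · exact (this hq hp (le_of_not_ge hpq)).symm
  rw [darn_eq_iff hF hpq, disjoint_iff_inter_eq_empty.1, measure_empty]
  refine (hCF.mono_left fun t ht => ?_).symm
  obtain ⟨a, ha, haC⟩ := mem_closure_iff.1 hp _ isOpen_Iio ht.1
  obtain ⟨b, hb, hbC⟩ := mem_closure_iff.1 hq _ isOpen_Ioi ht.2
  exact hC.ordConnected.out haC hbC ⟨le_of_lt ha, le_of_lt hb⟩

/-- A point of `F` strictly between `p` and `q` would contribute positive mass and separate their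
images. Hence `(p, q)` is a connected part of `G`, and the component containing it has both points
in its closure. -/
theorem mem_closure_component_of_darn_eq {G : Set ℝ} (hF : MeasurableSet F) (hFG : F = Gᶜ)
    (hpos : ∀ x ∈ F, ∀ ε > 0, 0 < volume (F ∩ Ioo (x - ε) (x + ε))) {p q : ℝ}
    (hpq : p < q) (h : darn F z p = darn F z q) :
    ∃ x ∈ G, p ∈ closure (connectedComponentIn G x) ∧
      q ∈ closure (connectedComponentIn G x) := by
  have h0 := (darn_eq_iff hF hpq.le).1 h
  have hsub : Ioo p q ⊆ G := by
    intro x hx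
    by_contra hxG
    have hxF : x ∈ F := by rw [hFG]; exact hxG
    have hε : 0 < min (x - p) (q - x) := lt_min (sub_pos.2 hx.1) (sub_pos.2 hx.2)
    refine (hpos x hxF _ hε).ne' (measure_mono_null (inter_subset_inter_right _ ?_) h0)
    refine Ioo_subset_Ioo ?_ ?_
    · linarith [min_le_left (x - p) (q - x)]
    · linarith [min_le_right (x - p) (q - x)]
  have hx : (p + q) / 2 ∈ Ioo p q := ⟨by linarith, by linarith⟩
  have hc : Icc p q ⊆ closure (connectedComponentIn G ((p + q) / 2)) := by
    rw [← closure_Ioo hpq.ne]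
    exact closure_mono (isPreconnected_Ioo.subset_connectedComponentIn hx hsub)
  exact ⟨_, hsub hx, hc (left_mem_Icc.2 hpq.le), hc (right_mem_Icc.2 hpq.le)⟩

end Darning

end

noncomputable section

namespace Darning

/-! ### Forms on `L²` -/

namespace L2Form

variable {E E' : Type*} [MeasurableSpace E] [MeasurableSpace E'] {ξ : Measure E} {ξ' : Measure E'}

/-- `ofFunctions` evaluates the form on chosen representatives; when a.e. equal members of `V`
coincide, the choice has no effect. -/
theorem ofFunctions_form {V : Set (E → ℝ)} {B : (E → ℝ) → (E → ℝ) → ℝ}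
    (hV : ∀ u ∈ V, ∀ v ∈ V, u =ᵐ[ξ] v → u = v) {f g : Lp ℝ 2 ξ} {u v : E → ℝ}
    (hu : u ∈ V) (hv : v ∈ V) (hf : f =ᵐ[ξ] u) (hg : g =ᵐ[ξ] v) :
    (ofFunctions ξ V B).form f g = B u v := by
  have h : (∃ u ∈ V, f =ᵐ[ξ] u) ∧ (∃ v ∈ V, g =ᵐ[ξ] v) := ⟨⟨u, hu, hf⟩, ⟨v, hv, hg⟩⟩
  simp only [ofFunctions, dif_pos h]
  rw [hV _ h.1.choose_spec.1 u hu (h.1.choose_spec.2.symm.trans hf),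
    hV _ h.2.choose_spec.1 v hv (h.2.choose_spec.2.symm.trans hg)]

theorem IsDSpace.sub_mem {D : L2Form ξ} (hD : D.IsDSpace) {f g : Lp ℝ 2 ξ} (hf : f ∈ D.dom)
    (hg : g ∈ D.dom) : f - g ∈ D.dom := by
  have := hD.add_mem f hf _ (hD.smul_mem (-1) g hg)
  rwa [neg_one_smul, ← sub_eq_add_neg] at this

/-- A form that corresponds to a D-space under a linear isometry of `L²` spaces compatible with
normal contractions is a D-space. -/
theorem IsDSpace.pullback {D : L2Form ξ} {D' : L2Form ξ'} (hD : D.IsDSpace)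
    (I : Lp ℝ 2 ξ' →ₗᵢ[ℝ] Lp ℝ 2 ξ) (hrange : ∀ f ∈ D.dom, ∃ g, I g = f)
    (hdom : ∀ g, g ∈ D'.dom ↔ I g ∈ D.dom)
    (hform : ∀ f ∈ D'.dom, ∀ g ∈ D'.dom, D'.form f g = D.form (I f) (I g))
    (hcomp : ∀ (φ : ℝ → ℝ) (hφ : LipschitzWith 1 φ) (h0 : φ 0 = 0) f,
      I (hφ.compLp h0 f) = hφ.compLp h0 (I f)) : D'.IsDSpace := by
  have hadd : ∀ f ∈ D'.dom, ∀ g ∈ D'.dom, f + g ∈ D'.dom := fun f hf g hg => by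
    rw [hdom] at *
    rw [map_add]
    exact hD.add_mem _ hf _ hg
  have hsmul : ∀ (c : ℝ), ∀ f ∈ D'.dom, c • f ∈ D'.dom := fun c f hf => by
    rw [hdom] at *
    rw [map_smul]
    exact hD.smul_mem _ _ hf
  have hsub : ∀ f ∈ D'.dom, ∀ g ∈ D'.dom, f - g ∈ D'.dom := fun f hf g hg => by
    rw [hdom] at *
    rw [map_sub]
    exact hD.sub_mem hf hg
  have hsq : ∀ f ∈ D'.dom, D'.sq1 f = D.sq1 (I f) := fun f hf => by
    rw [sq1, sq1, hform f hf f hf, I.norm_map]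
  have hmk : ∀ (φ : ℝ → ℝ) (hφ : LipschitzWith 1 φ) (h0 : φ 0 = 0), ∀ f ∈ D'.dom,
      hφ.compLp h0 f ∈ D'.dom := fun φ hφ h0 f hf => by
    rw [hdom] at *
    rw [hcomp]
    exact (hD.markov φ hφ h0 _ hf).1
  refine ⟨?_, hadd, hsmul, ?_, ?_, ?_, ?_, ?_, ?_⟩
  · rw [hdom, map_zero]
    exact hD.zero_mem
  · intro f hf g hg
    rw [hform f hf g hg, hform g hg f hf]
    exact hD.symm _ ((hdom f).1 hf) _ ((hdom g).1 hg)
  · intro f hf g hg h hh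
    rw [hform _ (hadd f hf g hg) h hh, hform f hf h hh, hform g hg h hh, map_add]
    exact hD.add_left _ ((hdom f).1 hf) _ ((hdom g).1 hg) _ ((hdom h).1 hh)
  · intro c f hf g hg
    rw [hform _ (hsmul c f hf) g hg, hform f hf g hg, map_smul]
    exact hD.smul_left _ _ ((hdom f).1 hf) _ ((hdom g).1 hg)
  · intro f hf
    rw [hform f hf f hf]
    exact hD.nonneg _ ((hdom f).1 hf)
  · intro f hf hc
    obtain ⟨g, hg, hlim⟩ := hD.closed (fun n => I (f n)) (fun n => (hdom _).1 (hf n))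
      fun ε hε => by
        obtain ⟨N, hN⟩ := hc ε hε
        refine ⟨N, fun m hm n hn => ?_⟩
        rw [← map_sub, ← hsq _ (hsub _ (hf m) _ (hf n))]
        exact hN m hm n hn
    obtain ⟨g, rfl⟩ := hrange g hg
    refine ⟨g, (hdom g).2 hg, hlim.congr fun n => ?_⟩
    rw [hsq _ (hsub _ (hf n) _ ((hdom g).2 hg)), map_sub]
  · intro φ hφ h0 f hf
    refine ⟨hmk φ hφ h0 f hf, ?_⟩
    rw [hform _ (hmk φ hφ h0 f hf) _ (hmk φ hφ h0 f hf), hform f hf f hf, hcomp]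
    exact (hD.markov φ hφ h0 _ ((hdom f).1 hf)).2

section MeasurePreserving

variable {j : E → E'} (hj : MeasurePreserving j ξ ξ')

/-- The descent from `ξ` to `ξ'` passes through strongly measurable versions, because `ae_map_iff`
needs the equality set to be measurable. -/
theorem compMeasurePreserving_ae_iff {f : Lp ℝ 2 ξ'} {g : E' → ℝ}
    (hg : AEStronglyMeasurable g ξ') :
    (Lp.compMeasurePreservingₗᵢ ℝ j hj f : Lp ℝ 2 ξ) =ᵐ[ξ] g ∘ j ↔ f =ᵐ[ξ'] g := by
  have h1 : (Lp.compMeasurePreservingₗᵢ ℝ j hj f : Lp ℝ 2 ξ) =ᵐ[ξ] f ∘ j :=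
    Lp.coeFn_compMeasurePreserving f hj
  constructor
  · intro h
    have h2 := h1.symm.trans h
    obtain ⟨f', hf', hff⟩ := Lp.aestronglyMeasurable f
    obtain ⟨g', hg', hgg⟩ := hg
    refine hff.trans (EventuallyEq.trans ?_ hgg.symm)
    have h3 : ∀ᵐ x ∂ξ, f' (j x) = g' (j x) := by
      filter_upwards [hj.quasiMeasurePreserving.ae hff, hj.quasiMeasurePreserving.ae hgg, h2]
        with x h3 h4 h5
      rw [← h3, ← h4]
      exact h5
    have h4 := (ae_map_iff hj.measurable.aemeasurable
      (measurableSet_eq_fun hf'.measurable hg'.measurable)).2 h3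
    rwa [hj.map_eq] at h4
  · intro h
    exact h1.trans (hj.quasiMeasurePreserving.ae_eq_comp h)

theorem compMeasurePreserving_compLp (φ : ℝ → ℝ) (hφ : LipschitzWith 1 φ) (h0 : φ 0 = 0)
    (f : Lp ℝ 2 ξ') : Lp.compMeasurePreservingₗᵢ ℝ j hj (hφ.compLp h0 f) =
      hφ.compLp h0 (Lp.compMeasurePreservingₗᵢ ℝ j hj f : Lp ℝ 2 ξ) := by
  refine Lp.ext ?_
  have h1 : (Lp.compMeasurePreservingₗᵢ ℝ j hj f : Lp ℝ 2 ξ) =ᵐ[ξ] f ∘ j :=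
    Lp.coeFn_compMeasurePreserving f hj
  have h2 := (compMeasurePreserving_ae_iff hj (f := hφ.compLp h0 f)
    (hφ.continuous.comp_aestronglyMeasurable (Lp.aestronglyMeasurable f))).2
    (hφ.coeFn_compLp h0 f)
  refine h2.trans (EventuallyEq.trans ?_ (hφ.coeFn_compLp h0 _).symm)
  filter_upwards [h1] with x hx
  exact congrArg φ hx.symm

theorem eLpNorm_compMeasurePreserving (f : Lp ℝ 2 ξ') (p : ℝ≥0∞) :
    eLpNorm (Lp.compMeasurePreservingₗᵢ ℝ j hj f : Lp ℝ 2 ξ) p ξ = eLpNorm f p ξ' := by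
  refine (eLpNorm_congr_ae (Lp.coeFn_compMeasurePreserving f hj)).trans ?_
  exact eLpNorm_comp_measurePreserving (Lp.aestronglyMeasurable f) hj

/-- A measure preserving map under which the domains and forms correspond induces an equivalence
of D-spaces. -/
theorem Equivalent.of_measurePreserving {D : L2Form ξ} {D' : L2Form ξ'} (hD : D.IsDSpace)
    (hrange : ∀ f ∈ D.dom, ∃ g, Lp.compMeasurePreservingₗᵢ ℝ j hj g = f)
    (hdom : ∀ g, g ∈ D'.dom ↔ Lp.compMeasurePreservingₗᵢ ℝ j hj g ∈ D.dom)
    (hform : ∀ f ∈ D'.dom, ∀ g ∈ D'.dom, D'.form f g =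
      D.form (Lp.compMeasurePreservingₗᵢ ℝ j hj f) (Lp.compMeasurePreservingₗᵢ ℝ j hj g))
    (hmul : ∀ f ∈ D.bdd, ∀ g ∈ D.bdd, ∃ h ∈ D.bdd, h =ᵐ[ξ] fun x => f x * g x) :
    D.Equivalent D' := by
  set I : Lp ℝ 2 ξ' →ₗᵢ[ℝ] Lp ℝ 2 ξ := Lp.compMeasurePreservingₗᵢ ℝ j hj with hI
  -- Composition with `j` goes from L²(ξ') to L²(ξ), so the required isomorphism is its inverse;
  -- values of `invFun` off the range of `I` never matter, as `D.dom` lies in that range.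
  have hΦ : ∀ g, Function.invFun I (I g) = g := Function.leftInverse_invFun I.injective
  have hbdd : ∀ g, I g ∈ D.bdd ↔ g ∈ D'.bdd := fun g => by
    refine and_congr (hdom g).symm ?_
    rw [MemLp, MemLp, hI, eLpNorm_compMeasurePreserving hj g ∞]
    exact and_congr_left fun _ => iff_of_true (Lp.aestronglyMeasurable _) (Lp.aestronglyMeasurable _)
  have hsurj : ∀ f ∈ D.bdd, ∃ g ∈ D'.bdd, I g = f := fun f hf => by
    obtain ⟨g, rfl⟩ := hrange f hf.1
    exact ⟨g, (hbdd g).1 hf, rfl⟩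
  refine ⟨hD, hD.pullback I hrange hdom hform (compMeasurePreserving_compLp hj),
    Function.invFun I, ⟨?_, ?_, ?_⟩, ?_, ?_, ?_, ?_⟩
  · intro f hf
    obtain ⟨g, hg, rfl⟩ := hsurj f hf
    rwa [hΦ]
  · intro f hf f' hf' h
    obtain ⟨g, -, rfl⟩ := hsurj f hf
    obtain ⟨g', -, rfl⟩ := hsurj f' hf'
    rw [hΦ, hΦ] at h
    rw [h]
  · intro g hg
    exact ⟨I g, (hbdd g).2 hg, hΦ g⟩
  · intro f hf f' hf'
    obtain ⟨g, -, rfl⟩ := hsurj f hf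
    obtain ⟨g', -, rfl⟩ := hsurj f' hf'
    rw [← map_add, hΦ, hΦ, hΦ]
  · intro c f hf
    obtain ⟨g, -, rfl⟩ := hsurj f hf
    rw [← map_smul, hΦ, hΦ]
  · intro f hf f' hf'
    obtain ⟨h, hh, hprod⟩ := hmul f hf f' hf'
    obtain ⟨g, -, rfl⟩ := hsurj f hf
    obtain ⟨g', -, rfl⟩ := hsurj f' hf'
    refine ⟨h, hh, hprod, ?_⟩
    obtain ⟨k, -, rfl⟩ := hsurj h hh
    rw [hΦ, hΦ, hΦ]
    refine (compMeasurePreserving_ae_iff hj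
      ((Lp.aestronglyMeasurable g).mul (Lp.aestronglyMeasurable g'))).1 (hprod.trans ?_)
    filter_upwards [Lp.coeFn_compMeasurePreserving g hj, Lp.coeFn_compMeasurePreserving g' hj]
      with x h1 h2
    exact congrArg₂ (· * ·) h1 h2
  · intro f hf
    obtain ⟨g, hg, rfl⟩ := hsurj f hf
    rw [hΦ, ← hform g hg.1 g hg.1, I.inner_map_map]
    exact ⟨eLpNorm_compMeasurePreserving hj g ∞, rfl, rfl⟩

end MeasurePreserving

end L2Form

/-! ### The energy form on functions that are flat off `F` -/

theorem AbsContOn.add {J : Set ℝ} {u v : ℝ → ℝ} (hu : AbsContOn J u) (hv : AbsContOn J v) :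
    AbsContOn J (u + v) := fun a ha b hb => (hu a ha b hb).add (hv a ha b hb)

theorem AbsContOn.sub {J : Set ℝ} {u v : ℝ → ℝ} (hu : AbsContOn J u) (hv : AbsContOn J v) :
    AbsContOn J (u - v) := fun a ha b hb => (hu a ha b hb).sub (hv a ha b hb)

theorem AbsContOn.mul {J : Set ℝ} {u v : ℝ → ℝ} (hu : AbsContOn J u) (hv : AbsContOn J v) :
    AbsContOn J (u * v) := fun a ha b hb => (hu a ha b hb).mul (hv a ha b hb)

theorem AbsContOn.const_smul {J : Set ℝ} {u : ℝ → ℝ} (c : ℝ) (hu : AbsContOn J u) :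
    AbsContOn J (c • u) := fun a ha b hb => (hu a ha b hb).const_smul c

theorem AbsContOn.lipschitz_comp {J : Set ℝ} {u φ : ℝ → ℝ} (hφ : LipschitzWith 1 φ)
    (hu : AbsContOn J u) : AbsContOn J (φ ∘ u) := fun a ha b hb =>
  squeeze_zero (fun _ => Finset.sum_nonneg fun _ _ => dist_nonneg)
    (fun _ => Finset.sum_le_sum fun _ _ => by simpa using hφ.dist_le_mul _ _) (hu a ha b hb)

theorem AbsContOn.deriv_add {u v : ℝ → ℝ} (hu : AbsContOn univ u) (hv : AbsContOn univ v) :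
    deriv (u + v) =ᵐ[volume] deriv u + deriv v := by
  filter_upwards [hu.ae_hasDerivAt_univ, hv.ae_hasDerivAt_univ] with x h1 h2
  exact (h1.add h2).deriv

theorem AbsContOn.deriv_sub {u v : ℝ → ℝ} (hu : AbsContOn univ u) (hv : AbsContOn univ v) :
    deriv (u - v) =ᵐ[volume] deriv u - deriv v := by
  filter_upwards [hu.ae_hasDerivAt_univ, hv.ae_hasDerivAt_univ] with x h1 h2
  exact (h1.sub h2).deriv

theorem AbsContOn.deriv_const_smul {u : ℝ → ℝ} (c : ℝ) (hu : AbsContOn univ u) :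
    deriv (c • u) =ᵐ[volume] c • deriv u := by
  filter_upwards [hu.ae_hasDerivAt_univ] with x h1
  exact (h1.const_smul c).deriv

theorem AbsContOn.deriv_mul {u v : ℝ → ℝ} (hu : AbsContOn univ u) (hv : AbsContOn univ v) :
    deriv (u * v) =ᵐ[volume] deriv u * v + u * deriv v := by
  filter_upwards [hu.ae_hasDerivAt_univ, hv.ae_hasDerivAt_univ] with x h1 h2
  exact (h1.mul h2).deriv

theorem norm_deriv_lipschitz_comp_le {u φ : ℝ → ℝ} (hφ : LipschitzWith 1 φ) {x : ℝ}
    (hu : DifferentiableAt ℝ u x) : ‖deriv (φ ∘ u) x‖ ≤ ‖deriv u x‖ := by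
  by_cases h : DifferentiableAt ℝ (φ ∘ u) x
  · refine le_of_tendsto_of_tendsto' (hasDerivAt_iff_tendsto_slope.1 h.hasDerivAt).norm
      (hasDerivAt_iff_tendsto_slope.1 hu.hasDerivAt).norm fun y => ?_
    rw [slope_def_module, slope_def_module, norm_smul, norm_smul]
    gcongr
    simpa [dist_eq_norm] using hφ.dist_le_mul (u y) (u x)
  -- At points where `φ ∘ u` is not differentiable, `deriv` has the default value 0.
  · simp [deriv_zero_of_not_differentiableAt h]

theorem AbsContOn.norm_deriv_lipschitz_comp_le {u φ : ℝ → ℝ} (hφ : LipschitzWith 1 φ)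
    (hu : AbsContOn univ u) : ∀ᵐ x, ‖deriv (φ ∘ u) x‖ ≤ ‖deriv u x‖ :=
  hu.ae_hasDerivAt_univ.mono fun _ hx =>
    Darning.norm_deriv_lipschitz_comp_le hφ hx.differentiableAt

variable {F : Set ℝ} {u v w : ℝ → ℝ}

theorem zero_mem_flatOff : (0 : ℝ → ℝ) ∈ flatOff F := by
  have h : deriv (0 : ℝ → ℝ) = 0 := by ext x; exact deriv_const x 0
  refine ⟨⟨fun a _ b _ => ?_, ?_⟩, ?_⟩
  · exact ((LipschitzWith.const (0 : ℝ)).lipschitzOnWith).absolutelyContinuousOnInterval (K := 0)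
  · rw [h]; exact MemLp.zero
  · simp [h]

theorem add_mem_flatOff (hu : u ∈ flatOff F) (hv : v ∈ flatOff F) : u + v ∈ flatOff F := by
  have h := hu.1.1.deriv_add hv.1.1
  refine ⟨⟨hu.1.1.add hv.1.1, (memLp_congr_ae h).2 (hu.1.2.add hv.1.2)⟩, ?_⟩
  filter_upwards [h, hu.2, hv.2] with x h1 h2 h3 hx
  simp [h1, h2 hx, h3 hx]

theorem sub_mem_flatOff (hu : u ∈ flatOff F) (hv : v ∈ flatOff F) : u - v ∈ flatOff F := by
  have h := hu.1.1.deriv_sub hv.1.1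
  refine ⟨⟨hu.1.1.sub hv.1.1, (memLp_congr_ae h).2 (hu.1.2.sub hv.1.2)⟩, ?_⟩
  filter_upwards [h, hu.2, hv.2] with x h1 h2 h3 hx
  simp [h1, h2 hx, h3 hx]

theorem const_smul_mem_flatOff (c : ℝ) (hu : u ∈ flatOff F) : c • u ∈ flatOff F := by
  have h := hu.1.1.deriv_const_smul c
  refine ⟨⟨hu.1.1.const_smul c, (memLp_congr_ae h).2 (hu.1.2.const_smul c)⟩, ?_⟩
  filter_upwards [h, hu.2] with x h1 h2 hx
  simp [h1, h2 hx]

theorem lipschitz_comp_mem_flatOff {φ : ℝ → ℝ} (hφ : LipschitzWith 1 φ) (hu : u ∈ flatOff F) :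
    φ ∘ u ∈ flatOff F := by
  have h := hu.1.1.norm_deriv_lipschitz_comp_le hφ
  refine ⟨⟨hu.1.1.lipschitz_comp hφ,
    hu.1.2.mono (measurable_deriv _).aestronglyMeasurable h⟩, ?_⟩
  filter_upwards [h, hu.2] with x h1 h2 hx
  rw [h2 hx, norm_zero] at h1
  exact norm_le_zero_iff.1 h1

theorem mul_mem_flatOff (hu : u ∈ flatOff F) (hv : v ∈ flatOff F) {M N : ℝ}
    (hM : ∀ x, ‖u x‖ ≤ M) (hN : ∀ x, ‖v x‖ ≤ N) : u * v ∈ flatOff F := by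
  have h := hu.1.1.deriv_mul hv.1.1
  have h1 : MemLp (deriv u * v) 2 volume := by
    refine hu.1.2.of_le_mul (c := N) ((measurable_deriv u).mul
      hv.1.1.continuous.measurable).aestronglyMeasurable (Eventually.of_forall fun x => ?_)
    rw [Pi.mul_apply, norm_mul, mul_comm]
    gcongr
    exact hN x
  have h2 : MemLp (u * deriv v) 2 volume := by
    refine hv.1.2.of_le_mul (c := M) (hu.1.1.continuous.measurable.mul
      (measurable_deriv v)).aestronglyMeasurable (Eventually.of_forall fun x => ?_)
    rw [Pi.mul_apply, norm_mul]
    gcongr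
    exact hM x
  refine ⟨⟨hu.1.1.mul hv.1.1, (memLp_congr_ae h).2 (h1.add h2)⟩, ?_⟩
  filter_upwards [h, hu.2, hv.2] with x h1 h2 h3 hx
  simp [h1, h2 hx, h3 hx]

theorem eq_of_ae_eq_of_flatOff (hu : u ∈ flatOff F) (hv : v ∈ flatOff F) (h : u =ᵐ[volume] v) :
    u = v :=
  (hu.1.1.continuous.ae_eq_iff_eq volume hv.1.1.continuous).1 h

theorem energy_comm (u v : ℝ → ℝ) : energy u v = energy v u := by
  simp only [energy, mul_comm]

theorem energy_add_left (hu : u ∈ flatOff F) (hv : v ∈ flatOff F) (hw : w ∈ flatOff F) :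
    energy (u + v) w = energy u w + energy v w := by
  rw [energy, energy, energy, ← mul_add]
  congr 1
  refine Eq.trans ?_ (integral_add (hu.1.2.integrable_mul hw.1.2)
    (hv.1.2.integrable_mul hw.1.2))
  refine integral_congr_ae ?_
  filter_upwards [hu.1.1.deriv_add hv.1.1] with x hx
  simp [hx, add_mul]

theorem energy_smul_left (c : ℝ) (hu : u ∈ flatOff F) :
    energy (c • u) w = c * energy u w := by
  have h : ∫ x, deriv (c • u) x * deriv w x = ∫ x, c * (deriv u x * deriv w x) := by
    refine integral_congr_ae ?_
    filter_upwards [hu.1.1.deriv_const_smul c] with x hx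
    simp [hx, mul_assoc]
  rw [energy, energy, h, integral_const_mul, mul_left_comm]

theorem energy_self (hu : u ∈ flatOff F) : energy u u = (1 / 2) * ‖hu.1.2.toLp (deriv u)‖ ^ 2 := by
  rw [energy, ← real_inner_self_eq_norm_sq (F := Lp ℝ 2 (volume : Measure ℝ)), L2.inner_def]
  congr 1
  refine integral_congr_ae ?_
  filter_upwards [hu.1.2.coeFn_toLp] with x hx
  simp [hx, sq]

theorem energy_self_mono (hu : u ∈ flatOff F) (hv : v ∈ flatOff F)
    (h : ∀ᵐ x, ‖deriv u x‖ ≤ ‖deriv v x‖) : energy u u ≤ energy v v := by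
  rw [energy_self hu, energy_self hv, Lp.norm_toLp, Lp.norm_toLp]
  gcongr
  · exact hv.1.2.eLpNorm_ne_top
  · exact eLpNorm_mono_ae h

theorem energy_sub_self (hu : u ∈ flatOff F) (hv : v ∈ flatOff F) : energy (u - v) (u - v) =
    (1 / 2) * ‖hu.1.2.toLp (deriv u) - hv.1.2.toLp (deriv v)‖ ^ 2 := by
  rw [energy_self (sub_mem_flatOff hu hv), ← MemLp.toLp_sub]
  congr 3
  exact MemLp.toLp_congr _ _ (hu.1.1.deriv_sub hv.1.1)

/-- The form on `L²(ℝ)` given by the energy of functions that are flat off `F`. -/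
def flatForm (F : Set ℝ) : L2Form (volume : Measure ℝ) :=
  L2Form.ofFunctions volume (flatOff F) energy

theorem flatForm_form {f g : Lp ℝ 2 (volume : Measure ℝ)} (hu : u ∈ flatOff F) (hv : v ∈ flatOff F)
    (hf : f =ᵐ[volume] u) (hg : g =ᵐ[volume] v) : (flatForm F).form f g = energy u v :=
  L2Form.ofFunctions_form (fun _ h1 _ h2 h => eq_of_ae_eq_of_flatOff h1 h2 h) hu hv hf hg

theorem flatForm_sq1_sub {f g : Lp ℝ 2 (volume : Measure ℝ)} (hu : u ∈ flatOff F)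
    (hv : v ∈ flatOff F) (hf : f =ᵐ[volume] u) (hg : g =ᵐ[volume] v) :
    (flatForm F).sq1 (f - g) =
      (1 / 2) * ‖hu.1.2.toLp (deriv u) - hv.1.2.toLp (deriv v)‖ ^ 2 + ‖f - g‖ ^ 2 := by
  have h : (f - g : Lp ℝ 2 (volume : Measure ℝ)) =ᵐ[volume] u - v :=
    (Lp.coeFn_sub f g).trans (hf.sub hg)
  rw [L2Form.sq1, flatForm_form (sub_mem_flatOff hu hv) (sub_mem_flatOff hu hv) h h,
    energy_sub_self hu hv]

theorem cauchySeq_of_norm_sub_sq {H : Type*} [NormedAddCommGroup H] {f : ℕ → H}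
    (h : ∀ ε > 0, ∃ N, ∀ m ≥ N, ∀ n ≥ N, ‖f m - f n‖ ^ 2 < ε) : CauchySeq f := by
  rw [Metric.cauchySeq_iff]
  intro ε hε
  obtain ⟨N, hN⟩ := h (ε ^ 2) (by positivity)
  refine ⟨N, fun m hm n hn => ?_⟩
  rw [dist_eq_norm]
  exact lt_of_pow_lt_pow_left₀ 2 hε.le (hN m hm n hn)

/-- Completeness of the Sobolev space H¹: both the functions and their derivatives are Cauchy in L²,
and a primitive of the limit `e` of the derivatives is a version of the limit `g` of the functions.
-/
theorem flatForm_closed (f : ℕ → Lp ℝ 2 (volume : Measure ℝ)) (hf : ∀ n, f n ∈ (flatForm F).dom)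
    (hc : ∀ ε > 0, ∃ N, ∀ m ≥ N, ∀ n ≥ N, (flatForm F).sq1 (f m - f n) < ε) :
    ∃ g ∈ (flatForm F).dom, Tendsto (fun n => (flatForm F).sq1 (f n - g)) atTop (𝓝 0) := by
  choose u hu hfu using hf
  set d : ℕ → Lp ℝ 2 (volume : Measure ℝ) := fun n => (hu n).1.2.toLp (deriv (u n)) with hd
  have hsq : ∀ m n, (flatForm F).sq1 (f m - f n) =
      (1 / 2) * ‖d m - d n‖ ^ 2 + ‖f m - f n‖ ^ 2 := fun m n =>
    flatForm_sq1_sub (hu m) (hu n) (hfu m) (hfu n)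
  have hCf : CauchySeq f := cauchySeq_of_norm_sub_sq fun ε hε => by
    obtain ⟨N, hN⟩ := hc ε hε
    refine ⟨N, fun m hm n hn => ?_⟩
    have := hN m hm n hn
    rw [hsq] at this
    nlinarith [sq_nonneg ‖d m - d n‖]
  have hCd : CauchySeq d := cauchySeq_of_norm_sub_sq fun ε hε => by
    obtain ⟨N, hN⟩ := hc (ε / 2) (by positivity)
    refine ⟨N, fun m hm n hn => ?_⟩
    have := hN m hm n hn
    rw [hsq] at this
    nlinarith [sq_nonneg ‖f m - f n‖]
  obtain ⟨g, hg⟩ := cauchySeq_tendsto_of_complete hCf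
  obtain ⟨e, he⟩ := cauchySeq_tendsto_of_complete hCd
  have hloc : LocallyIntegrable e volume := (Lp.memLp e).locallyIntegrable (by norm_num)
  have hii : ∀ a b, IntervalIntegrable e volume a b := fun a b =>
    ⟨(hloc.integrableOn_isCompact isCompact_Icc).mono_set Ioc_subset_Icc_self,
      (hloc.integrableOn_isCompact isCompact_Icc).mono_set Ioc_subset_Icc_self⟩
  have hint : ∀ a b, Tendsto (fun n => u n b - u n a) atTop (𝓝 (∫ x in a..b, e x)) := by
    intro a b
    have h1 : ∀ n, u n b - u n a = ∫ x in a..b, d n x := fun n => by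
      rw [← ((hu n).1.1.isPrimitiveOn a (mem_univ _) b (mem_univ _)).2]
      exact intervalIntegral.integral_congr_ae ((hu n).1.2.coeFn_toLp.symm.mono fun x hx _ => hx)
    simp only [h1, intervalIntegral]
    exact (tendsto_setIntegral_of_tendsto_L2 he measurableSet_Ioc (by simp)).sub
      (tendsto_setIntegral_of_tendsto_L2 he measurableSet_Ioc (by simp))
  obtain ⟨ns, hns, hlim⟩ := (tendstoInMeasure_of_tendsto_Lp hg).exists_seq_tendsto_ae
  have hlim' : ∀ᵐ x, Tendsto (fun i => u (ns i) x) atTop (𝓝 (g x)) := by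
    filter_upwards [hlim, ae_all_iff.2 hfu] with x h1 h2
    exact h1.congr fun i => h2 _
  obtain ⟨x₀, hx₀⟩ := hlim'.exists
  set v : ℝ → ℝ := fun x => g x₀ + ∫ t in x₀..x, e t with hv
  have hgv : g =ᵐ[volume] v := by
    filter_upwards [hlim'] with x hx
    refine tendsto_nhds_unique hx ?_
    have h1 := hx₀.add ((hint x₀ x).comp hns.tendsto_atTop)
    refine h1.congr fun i => ?_
    simp
  have hP : IsPrimitiveOn univ v e := fun a _ b _ => ⟨hii a b, by
    simp only [hv]
    rw [add_sub_add_left_eq_sub, intervalIntegral.integral_interval_sub_left (hii _ _) (hii _ _)]⟩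
  have hde : deriv v =ᵐ[volume] e := by simpa using hP.deriv_ae_eq ordConnected_univ
  have hvF : v ∈ flatOff F := by
    refine ⟨⟨hP.absContOn ordConnected_univ, (memLp_congr_ae hde).2 (Lp.memLp e)⟩, ?_⟩
    -- Flatness survives the limit because some subsequence of the derivatives converges almost
    -- everywhere.
    obtain ⟨ms, -, hlim2⟩ := (tendstoInMeasure_of_tendsto_Lp he).exists_seq_tendsto_ae
    filter_upwards [hde, hlim2, ae_all_iff.2 fun n => (hu n).1.2.coeFn_toLp,
      ae_all_iff.2 fun n => (hu n).2] with x h1 h2 h3 h4 hx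
    rw [h1]
    refine tendsto_nhds_unique h2 (tendsto_const_nhds.congr fun i => ?_)
    rw [hd]
    exact ((h3 (ms i)).trans (h4 (ms i) hx)).symm
  refine ⟨g, ⟨v, hvF, hgv⟩, ?_⟩
  have hev : hvF.1.2.toLp (deriv v) = e := by
    refine Lp.ext ?_
    exact hvF.1.2.coeFn_toLp.trans hde
  have hsq' : ∀ n, (flatForm F).sq1 (f n - g) =
      (1 / 2) * ‖d n - e‖ ^ 2 + ‖f n - g‖ ^ 2 := fun n => by
    rw [flatForm_sq1_sub (hu n) hvF (hfu n) hgv, hev]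
  simp only [hsq']
  have h1 := (((tendsto_iff_norm_sub_tendsto_zero.1 he).pow 2).const_mul (1 / 2)).add
    ((tendsto_iff_norm_sub_tendsto_zero.1 hg).pow 2)
  simpa using h1

theorem isDSpace_flatForm : (flatForm F).IsDSpace where
  zero_mem := ⟨0, zero_mem_flatOff, Lp.coeFn_zero _ _ _⟩
  add_mem := by
    rintro f ⟨u, hu, hfu⟩ g ⟨v, hv, hgv⟩
    exact ⟨u + v, add_mem_flatOff hu hv, (Lp.coeFn_add f g).trans (hfu.add hgv)⟩
  smul_mem := by
    rintro c f ⟨u, hu, hfu⟩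
    exact ⟨c • u, const_smul_mem_flatOff c hu, (Lp.coeFn_smul c f).trans (hfu.const_smul c)⟩
  symm := by
    rintro f ⟨u, hu, hfu⟩ g ⟨v, hv, hgv⟩
    rw [flatForm_form hu hv hfu hgv, flatForm_form hv hu hgv hfu, energy_comm]
  add_left := by
    rintro f ⟨u, hu, hfu⟩ g ⟨v, hv, hgv⟩ h ⟨w, hw, hhw⟩
    rw [flatForm_form hu hw hfu hhw, flatForm_form hv hw hgv hhw,
      flatForm_form (add_mem_flatOff hu hv) hw ((Lp.coeFn_add f g).trans (hfu.add hgv)) hhw,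
      energy_add_left hu hv hw]
  smul_left := by
    rintro c f ⟨u, hu, hfu⟩ g ⟨v, hv, hgv⟩
    rw [flatForm_form hu hv hfu hgv, flatForm_form (const_smul_mem_flatOff c hu) hv
      ((Lp.coeFn_smul c f).trans (hfu.const_smul c)) hgv, energy_smul_left c hu]
  nonneg := by
    rintro f ⟨u, hu, hfu⟩
    rw [flatForm_form hu hu hfu hfu, energy_self hu]
    positivity
  closed := flatForm_closed
  markov := by
    rintro φ hφ h0 f ⟨u, hu, hfu⟩
    have h : hφ.compLp h0 f =ᵐ[volume] φ ∘ u :=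
      (hφ.coeFn_compLp h0 f).trans (hfu.mono fun x hx => by simp [hx])
    have hm := lipschitz_comp_mem_flatOff hφ hu
    refine ⟨⟨φ ∘ u, hm, h⟩, ?_⟩
    rw [flatForm_form hm hm h h, flatForm_form hu hu hfu hfu]
    exact energy_self_mono hm hu (hu.1.1.norm_deriv_lipschitz_comp_le hφ)

/-- An essentially bounded continuous function is bounded everywhere, so both terms of the Leibniz
rule are bounded functions times L² functions. -/
theorem flatForm_mul_mem {f g : Lp ℝ 2 (volume : Measure ℝ)} (hf : f ∈ (flatForm F).bdd)
    (hg : g ∈ (flatForm F).bdd) :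
    ∃ h ∈ (flatForm F).bdd, h =ᵐ[volume] fun x => f x * g x := by
  have key : ∀ f ∈ (flatForm F).bdd, ∃ u ∈ flatOff F, f =ᵐ[volume] u ∧ ∃ M, ∀ x, ‖u x‖ ≤ M := by
    rintro f ⟨⟨u, hu, hfu⟩, hf⟩
    refine ⟨u, hu, hfu, (eLpNormEssSup u volume).toReal, fun x => ?_⟩
    have h1 : eLpNormEssSup u volume ≠ ∞ := by
      rw [← eLpNorm_exponent_top, ← eLpNorm_congr_ae hfu]
      exact hf.2.ne
    have h2 : ∀ᵐ x, ‖u x‖ ≤ (eLpNormEssSup u volume).toReal := by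
      filter_upwards [ae_le_eLpNormEssSup (f := u) (μ := volume)] with x hx
      rw [← toReal_enorm]
      exact ENNReal.toReal_mono h1 hx
    have h3 : IsClosed {x | ‖u x‖ ≤ (eLpNormEssSup u volume).toReal} :=
      isClosed_le hu.1.1.continuous.norm continuous_const
    have h4 : Dense {x | ‖u x‖ ≤ (eLpNormEssSup u volume).toReal} := Measure.dense_of_ae h2
    exact (h3.closure_eq ▸ h4.closure_eq ▸ mem_univ x :)
  obtain ⟨u, hu, hfu, M, hM⟩ := key f hf
  obtain ⟨v, hv, hgv, N, hN⟩ := key g hg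
  have hfg : (fun x => f x * g x) =ᵐ[volume] u * v := hfu.mul hgv
  have h2 : MemLp (fun x => f x * g x) 2 volume := (Lp.memLp g).mul hf.2
  refine ⟨h2.toLp _, ⟨⟨u * v, mul_mem_flatOff hu hv hM hN, h2.coeFn_toLp.trans hfg⟩, ?_⟩,
    h2.coeFn_toLp⟩
  rw [memLp_congr_ae h2.coeFn_toLp]
  exact hg.2.mul hf.2

end Darning

end

noncomputable section

namespace Darning

/-! ### Decay at infinity and truncation -/

/-- The derivative `2 u u'` of `u²` is integrable, so `u²` has a limit at each end of the line; as
`u²` is integrable, these limits are 0. -/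
theorem tendsto_cocompact_of_memLp {u : ℝ → ℝ} (hu : u ∈ Fe) (hu2 : MemLp u 2 volume) :
    Tendsto u (cocompact ℝ) (𝓝 0) := by
  have hac := hu.1.mul hu.1
  have hP := hac.isPrimitiveOn
  have hint : Integrable (deriv (u * u)) volume :=
    ((hu.2.integrable_mul hu2).add (hu2.integrable_mul hu.2)).congr (hu.1.deriv_mul hu.1).symm
  have hint2 : Integrable (u * u) volume := hu2.integrable_mul hu2
  have hx : ∀ x, (u * u) 0 + ∫ t in (0 : ℝ)..x, deriv (u * u) t = (u * u) x := fun x => by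
    rw [(hP 0 (mem_univ _) x (mem_univ _)).2]; ring
  have hx' : ∀ x, (u * u) 0 - ∫ t in x..(0 : ℝ), deriv (u * u) t = (u * u) x := fun x => by
    rw [(hP x (mem_univ _) 0 (mem_univ _)).2]; ring
  have htop : Tendsto (u * u) atTop (𝓝 0) := by
    have h1 := ((intervalIntegral_tendsto_integral_Ioi 0 hint.integrableOn
      (tendsto_id (α := ℝ))).const_add ((u * u) 0)).congr hx
    rwa [IntegrableAtFilter.eq_zero_of_tendsto (hint2.integrableAtFilter _) (fun s hs => ?_) h1]
      at h1
    obtain ⟨a, ha⟩ := mem_atTop_sets.1 hs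
    exact top_unique (by rw [← Real.volume_Ici (a := a)]; exact measure_mono ha)
  have hbot : Tendsto (u * u) atBot (𝓝 0) := by
    have h1 := ((intervalIntegral_tendsto_integral_Iic 0 hint.integrableOn
      (tendsto_id (α := ℝ))).const_sub ((u * u) 0)).congr hx'
    rwa [IntegrableAtFilter.eq_zero_of_tendsto (hint2.integrableAtFilter _) (fun s hs => ?_) h1]
      at h1
    obtain ⟨a, ha⟩ := mem_atBot_sets.1 hs
    exact top_unique (by rw [← Real.volume_Iic (a := a)]; exact measure_mono ha)
  have h := hbot.sup htop
  rw [← cocompact_eq_atBot_atTop] at h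
  rw [tendsto_zero_iff_abs_tendsto_zero]
  have h2 := (Real.continuous_sqrt.tendsto 0).comp h
  rw [Real.sqrt_zero] at h2
  exact h2.congr fun x => Real.sqrt_mul_self_eq_abs _

/-- Truncation of `t` to `[-δ, δ]`. -/
def clip (δ t : ℝ) : ℝ := max (-δ) (min δ t)

/-- Soft thresholding: the part of `t` that lies outside `[-δ, δ]`. -/
def soft (δ t : ℝ) : ℝ := t - clip δ t

theorem clip_of_abs_le {δ t : ℝ} (h : |t| ≤ δ) : clip δ t = t := by
  rw [abs_le] at h
  rw [clip, min_eq_right h.2, max_eq_right h.1]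

theorem soft_of_abs_le {δ t : ℝ} (h : |t| ≤ δ) : soft δ t = 0 := by
  rw [soft, clip_of_abs_le h, sub_self]

theorem clip_of_ge {δ t : ℝ} (hδ : 0 ≤ δ) (h : δ ≤ t) : clip δ t = δ := by
  rw [clip, min_eq_left h, max_eq_right (by linarith)]

theorem clip_of_le {δ t : ℝ} (hδ : 0 ≤ δ) (h : t ≤ -δ) : clip δ t = -δ := by
  rw [clip, min_eq_right (by linarith), max_eq_left h]

theorem abs_clip_le {δ : ℝ} (hδ : 0 ≤ δ) (t : ℝ) : |clip δ t| ≤ δ :=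
  abs_le.2 ⟨le_max_left _ _, max_le (by linarith) (min_le_left _ _)⟩

theorem lipschitzWith_clip (δ : ℝ) : LipschitzWith 1 (clip δ) :=
  (LipschitzWith.id.const_min δ).const_max (-δ)

theorem clip_zero {δ : ℝ} (hδ : 0 ≤ δ) : clip δ 0 = 0 := clip_of_abs_le (by simpa using hδ)

theorem monotone_clip (δ : ℝ) : Monotone (clip δ) := fun _ _ h =>
  max_le_max le_rfl (min_le_min le_rfl h)

theorem lipschitzWith_soft (δ : ℝ) : LipschitzWith 1 (soft δ) := by
  refine LipschitzWith.of_le_add fun x y => ?_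
  have h1 := (lipschitzWith_clip δ).dist_le_mul x y
  simp only [NNReal.coe_one, one_mul, Real.dist_eq, soft] at *
  rcases le_total x y with h | h
  · rw [abs_of_nonpos (sub_nonpos.2 (monotone_clip δ h)), abs_of_nonpos (sub_nonpos.2 h)] at *
    linarith
  · have := monotone_clip δ h
    rw [abs_of_nonneg (sub_nonneg.2 h)]
    linarith

theorem soft_zero {δ : ℝ} (hδ : 0 ≤ δ) : soft δ 0 = 0 := soft_of_abs_le (by simpa using hδ)

theorem deriv_clip_comp_eq_zero {δ : ℝ} (hδ : 0 ≤ δ) {u : ℝ → ℝ} {x : ℝ} (hu : ContinuousAt u x)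
    (h : δ < |u x|) : deriv (clip δ ∘ u) x = 0 := by
  rcases lt_abs.1 h with h | h
  · have : clip δ ∘ u =ᶠ[𝓝 x] fun _ => δ := by
      filter_upwards [hu.eventually (lt_mem_nhds h)] with y hy
      exact clip_of_ge hδ (le_of_lt hy)
    rw [this.deriv_eq, deriv_const]
  · have : clip δ ∘ u =ᶠ[𝓝 x] fun _ => -δ := by
      filter_upwards [hu.eventually (gt_mem_nhds (lt_neg.1 h))] with y hy
      exact clip_of_le hδ (le_of_lt hy)
    rw [this.deriv_eq, deriv_const]

/-- Dominated convergence with majorant `(u')²`: where `u ≠ 0` the truncation is locally constant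
once `δ n < |u|`, and almost everywhere on `u = 0` the derivative of `u` already vanishes. -/
theorem tendsto_energy_clip {F : Set ℝ} {u : ℝ → ℝ} (hu : u ∈ flatOff F) {δ : ℕ → ℝ}
    (hδ : ∀ n, 0 < δ n) (hlim : Tendsto δ atTop (𝓝 0)) :
    Tendsto (fun n => energy (clip (δ n) ∘ u) (clip (δ n) ∘ u)) atTop (𝓝 0) := by
  have h : Tendsto (fun n => ∫ x, deriv (clip (δ n) ∘ u) x * deriv (clip (δ n) ∘ u) x) atTop
      (𝓝 (∫ x : ℝ, (0 : ℝ))) := by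
    refine tendsto_integral_of_dominated_convergence (fun x => deriv u x * deriv u x)
      (fun n => ((measurable_deriv _).mul (measurable_deriv _)).aestronglyMeasurable)
      (hu.1.2.integrable_mul hu.1.2) (fun n => ?_) ?_
    · filter_upwards [hu.1.1.norm_deriv_lipschitz_comp_le (lipschitzWith_clip (δ n))] with x hx
      rw [norm_mul]
      refine (mul_le_mul hx hx (norm_nonneg _) (norm_nonneg _)).trans ?_
      rw [← norm_mul, Real.norm_of_nonneg (mul_self_nonneg _)]
    · filter_upwards [ae_all_iff.2 fun n =>
        hu.1.1.norm_deriv_lipschitz_comp_le (lipschitzWith_clip (δ n)),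
        ae_deriv_eq_zero_of_eq_zero (f := u) 0] with x h1 h2
      by_cases hx : u x = 0
      · have : ∀ n, deriv (clip (δ n) ∘ u) x = 0 := fun n => by
          have := h1 n
          rw [h2 hx, norm_zero] at this
          exact norm_le_zero_iff.1 this
        simp [this]
      · refine tendsto_const_nhds.congr' ?_
        filter_upwards [hlim.eventually (gt_mem_nhds (abs_pos.2 hx))] with n hn
        rw [deriv_clip_comp_eq_zero (hδ n).le hu.1.1.continuous.continuousAt hn, mul_zero]
  have h2 := h.const_mul (1 / 2)
  rwa [integral_zero, mul_zero] at h2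

theorem tendsto_norm_sub_soft {E : Type*} [MeasurableSpace E] {ξ : Measure E} (f : Lp ℝ 2 ξ)
    {δ : ℕ → ℝ} (hδ : ∀ n, 0 < δ n) (hlim : Tendsto δ atTop (𝓝 0)) :
    Tendsto (fun n => ‖f - (lipschitzWith_soft (δ n)).compLp (soft_zero (hδ n).le) f‖ ^ 2) atTop
      (𝓝 0) := by
  have hclip : ∀ n, f - (lipschitzWith_soft (δ n)).compLp (soft_zero (hδ n).le) f =ᵐ[ξ]
      fun x => clip (δ n) (f x) := fun n => by
    filter_upwards [Lp.coeFn_sub f ((lipschitzWith_soft (δ n)).compLp (soft_zero (hδ n).le) f),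
      (lipschitzWith_soft (δ n)).coeFn_compLp (soft_zero (hδ n).le) f] with x h1 h2
    rw [h1, Pi.sub_apply, h2]
    simp [soft]
  have hnorm : ∀ n, ‖f - (lipschitzWith_soft (δ n)).compLp (soft_zero (hδ n).le) f‖ ^ 2 =
      ∫ x, clip (δ n) (f x) * clip (δ n) (f x) ∂ξ := fun n => by
    rw [← real_inner_self_eq_norm_sq (F := Lp ℝ 2 ξ), L2.inner_def]
    refine integral_congr_ae ?_
    filter_upwards [hclip n] with x hx
    rw [hx]
    simp [sq]
  simp only [hnorm]
  have h : Tendsto (fun n => ∫ x, clip (δ n) (f x) * clip (δ n) (f x) ∂ξ) atTop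
      (𝓝 (∫ _ : E, (0 : ℝ) ∂ξ)) := by
    refine tendsto_integral_of_dominated_convergence (fun x => f x * f x)
      (fun n => ?_) ((Lp.memLp f).integrable_mul (Lp.memLp f)) (fun n => ?_) ?_
    · have := (lipschitzWith_clip (δ n)).continuous.comp_aestronglyMeasurable
        (Lp.aestronglyMeasurable f)
      exact this.mul this
    · refine Eventually.of_forall fun x => ?_
      have h1 : ‖clip (δ n) (f x)‖ ≤ ‖f x‖ := by
        have := (lipschitzWith_clip (δ n)).dist_le_mul (f x) 0
        simpa [clip_zero (hδ n).le] using this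
      rw [norm_mul]
      refine (mul_le_mul h1 h1 (norm_nonneg _) (norm_nonneg _)).trans ?_
      rw [← norm_mul, Real.norm_of_nonneg (mul_self_nonneg _)]
    · refine Eventually.of_forall fun x => ?_
      have h1 : Tendsto (fun n => clip (δ n) (f x)) atTop (𝓝 0) :=
        squeeze_zero_norm (fun n => abs_clip_le (hδ n).le _) hlim
      simpa using h1.mul h1
  simpa using h

theorem exists_sq1_sub_soft_lt {F : Set ℝ} {f : Lp ℝ 2 (volume : Measure ℝ)}
    (hf : f ∈ (flatForm F).dom) {ε : ℝ} (hε : 0 < ε) : ∃ δ, ∃ hδ : 0 < δ,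
      (flatForm F).sq1 (f - (lipschitzWith_soft δ).compLp (soft_zero hδ.le) f) < ε := by
  obtain ⟨u, hu, hfu⟩ := hf
  set δ : ℕ → ℝ := fun n => 1 / ((n : ℝ) + 1) with hδdef
  have hδ : ∀ n, 0 < δ n := fun n => Nat.one_div_pos_of_nat
  have hlim : Tendsto δ atTop (𝓝 0) := tendsto_one_div_add_atTop_nhds_zero_nat
  have hform : ∀ n, (flatForm F).sq1
      (f - (lipschitzWith_soft (δ n)).compLp (soft_zero (hδ n).le) f) =
      energy (clip (δ n) ∘ u) (clip (δ n) ∘ u) +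
        ‖f - (lipschitzWith_soft (δ n)).compLp (soft_zero (hδ n).le) f‖ ^ 2 := fun n => by
    have hm := lipschitz_comp_mem_flatOff (lipschitzWith_clip (δ n)) hu
    have h : (f - (lipschitzWith_soft (δ n)).compLp (soft_zero (hδ n).le) f :
        Lp ℝ 2 (volume : Measure ℝ)) =ᵐ[volume] clip (δ n) ∘ u := by
      filter_upwards [Lp.coeFn_sub f ((lipschitzWith_soft (δ n)).compLp (soft_zero (hδ n).le) f),
        (lipschitzWith_soft (δ n)).coeFn_compLp (soft_zero (hδ n).le) f, hfu] with x h1 h2 h3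
      rw [h1, Pi.sub_apply, h2]
      simp [soft, h3]
    rw [L2Form.sq1, flatForm_form hm hm h h]
  have h := (tendsto_energy_clip hu hδ hlim).add (tendsto_norm_sub_soft f hδ hlim)
  rw [add_zero] at h
  obtain ⟨n, hn⟩ := (h.eventually (gt_mem_nhds hε)).exists
  exact ⟨δ n, hδ n, by rw [hform]; exact hn⟩

/-! ### Extension by zero and atoms of infinite mass -/

namespace L2Form

variable {E : Type*} [MeasurableSpace E] {ξ : Measure E} {U : Set E}

theorem ae_comap_subtype_iff (hU : MeasurableSet U) {p : E → Prop} :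
    (∀ᵐ x : U ∂(ξ.comap (Subtype.val : U → E)), p x) ↔ ∀ᵐ x ∂ξ, x ∈ U → p x := by
  rw [← ae_restrict_iff' hU, ← map_comap_subtype_coe hU,
    (MeasurableEmbedding.subtype_coe hU).ae_map_iff]

theorem coeFn_zeroExt (hU : MeasurableSet U) (f : Lp ℝ 2 (ξ.comap (Subtype.val : U → E))) :
    zeroExt hU f =ᵐ[ξ] Function.extend Subtype.val f 0 :=
  (memLp_extend hU f).coeFn_toLp

theorem zeroExt_ae_eq_iff (hU : MeasurableSet U) {f : Lp ℝ 2 (ξ.comap (Subtype.val : U → E))}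
    {g : E → ℝ} (hg : ∀ x ∉ U, g x = 0) :
    zeroExt hU f =ᵐ[ξ] g ↔ f =ᵐ[ξ.comap (Subtype.val : U → E)] g ∘ Subtype.val := by
  have h1 := coeFn_zeroExt hU f
  have h2 : (∀ᵐ x : U ∂(ξ.comap (Subtype.val : U → E)), f x = g x) ↔
      ∀ᵐ x ∂ξ, x ∈ U → Function.extend Subtype.val f 0 x = g x := by
    rw [← ae_comap_subtype_iff hU (p := fun x => Function.extend Subtype.val f 0 x = g x)]
    refine eventually_congr (Eventually.of_forall fun x => ?_)
    rw [Subtype.val_injective.extend_apply]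
  refine Iff.trans ?_ h2.symm
  refine eventually_congr ?_
  filter_upwards [h1] with x hx
  by_cases hxU : x ∈ U
  · simp [hx, hxU]
  · rw [hx, Function.extend_apply' _ _ _ fun ⟨y, hy⟩ => hxU (hy ▸ y.2)]
    simp [hxU, hg x hxU]

theorem zeroExt_comp_val (hU : MeasurableSet U) (f : Lp ℝ 2 (ξ.comap (Subtype.val : U → E))) :
    (zeroExt hU f : E → ℝ) ∘ Subtype.val =ᵐ[ξ.comap (Subtype.val : U → E)] f := by
  have h := (ae_comap_subtype_iff hU).2 ((coeFn_zeroExt hU f).mono fun x hx _ => hx)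
  filter_upwards [h] with x hx
  rw [Function.comp_apply, hx, Subtype.val_injective.extend_apply]

theorem zeroExt_ae_zero (hU : MeasurableSet U) (f : Lp ℝ 2 (ξ.comap (Subtype.val : U → E))) :
    ∀ᵐ x ∂ξ, x ∉ U → zeroExt hU f x = 0 := by
  filter_upwards [coeFn_zeroExt hU f] with x hx hxU
  rw [hx, Function.extend_apply' _ _ _ fun ⟨y, hy⟩ => hxU (hy ▸ y.2)]
  rfl

theorem zeroExt_eq_iff (hU : MeasurableSet U) {f : Lp ℝ 2 (ξ.comap (Subtype.val : U → E))}
    {g : Lp ℝ 2 ξ} (hg : ∀ᵐ x ∂ξ, x ∉ U → g x = 0) :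
    zeroExt hU f = g ↔ f =ᵐ[ξ.comap (Subtype.val : U → E)] (g : E → ℝ) ∘ Subtype.val := by
  have h1 : g =ᵐ[ξ] U.indicator g := by
    filter_upwards [hg] with x hx
    by_cases hxU : x ∈ U <;> simp [hxU, hx]
  have h2 : U.indicator (g : E → ℝ) ∘ Subtype.val = (g : E → ℝ) ∘ (Subtype.val : U → E) := by
    ext x; simp
  rw [← h2, ← zeroExt_ae_eq_iff hU fun x hx => indicator_of_notMem hx _, Lp.ext_iff]
  exact ⟨fun h => h.trans h1, fun h => h.trans h1.symm⟩

/-- Extension by zero as a linear isometry. -/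
def zeroExtₗᵢ (hU : MeasurableSet U) :
    Lp ℝ 2 (ξ.comap (Subtype.val : U → E)) →ₗᵢ[ℝ] Lp ℝ 2 ξ where
  toFun := zeroExt hU
  map_add' f g := by
    refine (zeroExt_eq_iff hU ?_).2 ?_
    · filter_upwards [Lp.coeFn_add (zeroExt hU f) (zeroExt hU g), zeroExt_ae_zero hU f,
        zeroExt_ae_zero hU g] with x h1 h2 h3 hx
      rw [h1, Pi.add_apply, h2 hx, h3 hx, add_zero]
    · have h := (ae_comap_subtype_iff hU).2
        ((Lp.coeFn_add (zeroExt hU f) (zeroExt hU g)).mono fun x hx _ => hx)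
      filter_upwards [h, zeroExt_comp_val hU f, zeroExt_comp_val hU g, Lp.coeFn_add f g]
        with x h1 h2 h3 h4
      rw [h4, Function.comp_apply, h1, Pi.add_apply, Pi.add_apply, ← h2, ← h3]
      rfl
  map_smul' c f := by
    refine (zeroExt_eq_iff hU ?_).2 ?_
    · filter_upwards [Lp.coeFn_smul c (zeroExt hU f), zeroExt_ae_zero hU f] with x h1 h2 hx
      rw [RingHom.id_apply, h1, Pi.smul_apply, h2 hx, smul_zero]
    · have h := (ae_comap_subtype_iff hU).2
        ((Lp.coeFn_smul c (zeroExt hU f)).mono fun x hx _ => hx)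
      filter_upwards [h, zeroExt_comp_val hU f, Lp.coeFn_smul c f] with x h1 h2 h4
      rw [h4, Function.comp_apply, RingHom.id_apply, h1, Pi.smul_apply, Pi.smul_apply, ← h2]
      rfl
  norm_map' f := by
    change ‖zeroExt hU f‖ = ‖f‖
    rw [Lp.norm_def, Lp.norm_def, eLpNorm_congr_ae (zeroExt_comp_val hU f).symm,
      ← (MeasurableEmbedding.subtype_coe hU).eLpNorm_map_measure, map_comap_subtype_coe hU,
      ← eLpNorm_indicator_eq_eLpNorm_restrict hU]
    congr 1
    refine eLpNorm_congr_ae ?_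
    filter_upwards [zeroExt_ae_zero hU f] with x hx
    by_cases hxU : x ∈ U <;> simp [hxU, hx]

theorem zeroExt_surjective (hU : MeasurableSet U) {g : Lp ℝ 2 ξ}
    (hg : ∀ᵐ x ∂ξ, x ∉ U → g x = 0) : ∃ f, zeroExt hU f = g := by
  have h : MemLp ((g : E → ℝ) ∘ Subtype.val) 2 (ξ.comap (Subtype.val : U → E)) := by
    rw [← (MeasurableEmbedding.subtype_coe hU).memLp_map_measure_iff, map_comap_subtype_coe hU]
    exact (Lp.memLp g).restrict U
  exact ⟨h.toLp _, (zeroExt_eq_iff hU hg).2 h.coeFn_toLp⟩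

theorem zeroExt_compLp (hU : MeasurableSet U) (φ : ℝ → ℝ) (hφ : LipschitzWith 1 φ) (h0 : φ 0 = 0)
    (f : Lp ℝ 2 (ξ.comap (Subtype.val : U → E))) :
    zeroExt hU (hφ.compLp h0 f) = hφ.compLp h0 (zeroExt hU f) := by
  have h1 := hφ.coeFn_compLp h0 (zeroExt hU f)
  refine (zeroExt_eq_iff hU ?_).2 ?_
  · filter_upwards [h1, zeroExt_ae_zero hU f] with x h2 h3 hx
    rw [h2, Function.comp_apply, h3 hx, h0]
  · have h := (ae_comap_subtype_iff hU).2 (h1.mono fun x hx _ => hx)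
    filter_upwards [h, zeroExt_comp_val hU f, hφ.coeFn_compLp h0 f] with x h2 h3 h4
    rw [h4, Function.comp_apply, Function.comp_apply, h2, Function.comp_apply, ← h3]
    rfl

/-- By Chebyshev, the set where `|f|` is at least `|f x| > 0` would have finite measure, yet it
contains `x`. -/
theorem eq_zero_of_memLp_of_measure_singleton {f : E → ℝ} (hf : MemLp f 2 ξ) {x : E}
    (hx : ξ {x} = ∞) : f x = 0 := by
  by_contra h
  have h1 := hf.meas_ge_lt_top' (by norm_num) (by norm_num)
    (ε := (‖f x‖₊ : ℝ≥0∞)) (by simpa using h)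
  have h2 : ξ {x} < ∞ := lt_of_le_of_lt (measure_mono (by simp)) h1
  exact h2.ne hx

/-- Points of infinite mass force every L² function to vanish off `U`, so extension by zero is onto
and the structure pulls back. -/
theorem IsDSpace.restrictTo {D : L2Form ξ} (hD : D.IsDSpace) (hU : MeasurableSet U)
    (hatom : ∀ x ∉ U, ξ {x} = ∞) : (D.restrictTo hU).IsDSpace :=
  hD.pullback (zeroExtₗᵢ hU)
    (fun f _ => zeroExt_surjective hU (Eventually.of_forall fun x hx =>
      eq_zero_of_memLp_of_measure_singleton (Lp.memLp f) (hatom x hx)))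
    (fun _ => Iff.rfl) (fun _ _ _ _ => rfl) (zeroExt_compLp hU)

end L2Form

end Darning

end

noncomputable section

namespace Darning

/-! ### The interior of an interval -/

theorem exists_lt_lt_of_mem_interior {J : Set ℝ} {x : ℝ} (hx : x ∈ interior J) :
    ∃ a ∈ J, ∃ b ∈ J, a < x ∧ x < b := by
  obtain ⟨l, u, hlu, hsub⟩ := mem_nhds_iff_exists_Ioo_subset.1 (mem_interior_iff_mem_nhds.1 hx)
  exact ⟨(l + x) / 2, hsub ⟨by linarith [hlu.1], by linarith [hlu.1, hlu.2]⟩, (x + u) / 2,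
    hsub ⟨by linarith [hlu.1, hlu.2], by linarith [hlu.2]⟩, by linarith [hlu.1],
    by linarith [hlu.2]⟩

theorem mem_interior_of_lt_lt {J : Set ℝ} (hJ : J.OrdConnected) {a b x : ℝ} (ha : a ∈ J)
    (hb : b ∈ J) (hax : a < x) (hxb : x < b) : x ∈ interior J :=
  mem_interior_iff_mem_nhds.2 (mem_of_superset (Icc_mem_nhds hax hxb) (hJ.out ha hb))

/-- The inclusion of the interior of `J` into `ℝ`. -/
def inclInterior (J : Set ℝ) (x : interiorIn J) : ℝ := (x : J)

theorem range_inclInterior (J : Set ℝ) : range (inclInterior J) = interior J := by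
  ext x
  exact ⟨fun ⟨y, hy⟩ => hy ▸ y.2, fun hx => ⟨⟨⟨x, interior_subset hx⟩, hx⟩, rfl⟩⟩

theorem isOpenEmbedding_inclInterior (J : Set ℝ) : Topology.IsOpenEmbedding (inclInterior J) :=
  ⟨Topology.IsEmbedding.subtypeVal.comp Topology.IsEmbedding.subtypeVal,
    by rw [range_inclInterior]; exact isOpen_interior⟩

theorem isOpen_interiorIn (J : Set ℝ) : IsOpen (interiorIn J) :=
  isOpen_interior.preimage continuous_subtype_val

theorem continuous_extend_zero_of_isOpenEmbedding {X Y : Type*} [TopologicalSpace X]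
    [TopologicalSpace Y] [T2Space Y] {e : X → Y} (he : Topology.IsOpenEmbedding e) {φ : X → ℝ}
    (hφ : Continuous φ) (hc : HasCompactSupport φ) : Continuous (Function.extend e φ 0) := by
  refine continuous_of_tsupport fun y hy => ?_
  obtain ⟨x, -, rfl⟩ := hc.tsupport_extend_zero_subset he.continuous hy
  rw [← he.continuousAt_iff, Function.extend_comp he.injective]
  exact hφ.continuousAt

/-! ### The darned line -/

variable {F : Set ℝ} {z : ℝ}

theorem continuous_darnTo (hF : MeasurableSet F) : Continuous (darnTo F z) :=
  (continuous_darn hF).subtype_mk _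

theorem measurePreserving_darnTo (hF : MeasurableSet F) :
    MeasurePreserving (darnTo F z) volume (mj F z) :=
  ⟨(continuous_darnTo hF).measurable, rfl⟩

theorem isOpenPosMeasure_mj (hF : MeasurableSet F) : (mj F z).IsOpenPosMeasure := by
  refine ⟨fun U hU hne h0 => ?_⟩
  rw [mj, Measure.map_apply (continuous_darnTo hF).measurable hU.measurableSet] at h0
  refine (hU.preimage (continuous_darnTo hF)).measure_ne_zero volume ?_ h0
  exact hne.preimage (rangeFactorization_surjective (f := darn F z))

/-- A point of the interval `ℝ_j` outside the interior is its maximum or minimum; its fibre then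
contains a half-line, because `j` is monotone. -/
theorem mj_singleton_eq_top (hF : MeasurableSet F) {r : Rj F z} (hr : r ∉ interiorIn (Rj F z)) :
    mj F z {r} = ∞ := by
  have hJ := monotone_darn (z := z) hF
  obtain ⟨_, p, rfl⟩ := r
  have hsub : ∀ x, darn F z x = darn F z p → x ∈ darnTo F z ⁻¹' {⟨darn F z p, p, rfl⟩} :=
    fun x hx => Subtype.ext hx
  rw [mj, Measure.map_apply (continuous_darnTo hF).measurable (measurableSet_singleton _)]
  by_cases h : ∃ x, darn F z x < darn F z p
  · obtain ⟨x, hx⟩ := h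
    have hmax : ∀ y, darn F z y ≤ darn F z p := fun y => by
      by_contra hy
      exact hr (mem_interior_of_lt_lt (ordConnected_Rj hF) ⟨x, rfl⟩ ⟨y, rfl⟩ hx (not_le.1 hy))
    refine top_unique ?_
    rw [← Real.volume_Ici (a := p)]
    exact measure_mono fun y hy => hsub y (le_antisymm (hmax y) (hJ hy))
  · push Not at h
    refine top_unique ?_
    rw [← Real.volume_Iic (a := p)]
    exact measure_mono fun y hy => hsub y (le_antisymm (hJ hy) (h y))

/-- The functions on `ℝ_j` whose lift to `ℝ` is flat off `F`. -/
def flatJ (F : Set ℝ) (z : ℝ) : Set (Rj F z → ℝ) := {w | w ∘ darnTo F z ∈ flatOff F}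

/-- The energy form on `L²(ℝ_j, m_j)`. -/
def flatFormJ (F : Set ℝ) (z : ℝ) : L2Form (mj F z) :=
  L2Form.ofFunctions (mj F z) (flatJ F z) (energyJ F z)

theorem mem_flatJ_iff (hF : MeasurableSet F) {w : Rj F z → ℝ} :
    w ∈ flatJ F z ↔ AbsContOn (Rj F z) (ext0 w) ∧
      MemLp (deriv (ext0 w)) 2 (volume.restrict (Rj F z)) := by
  rw [← comp_darn_mem_flatOff_iff hF, ext0_comp_darn]
  rfl

theorem continuous_of_mem_flatJ (hF : MeasurableSet F) {w : Rj F z → ℝ} (hw : w ∈ flatJ F z) :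
    Continuous w := by
  have h := ((mem_flatJ_iff hF).1 hw).1.continuousOn
  rw [continuousOn_iff_continuous_domRestrict] at h
  convert h using 1
  ext r
  exact (Subtype.val_injective.extend_apply w 0 r).symm

/-- Composition with `j` as an isometry from `L²(ℝ_j, m_j)` to `L²(ℝ)`. -/
def liftJ (hF : MeasurableSet F) : Lp ℝ 2 (mj F z) →ₗᵢ[ℝ] Lp ℝ 2 (volume : Measure ℝ) :=
  Lp.compMeasurePreservingₗᵢ ℝ (darnTo F z) (measurePreserving_darnTo hF)

theorem liftJ_ae_eq_iff (hF : MeasurableSet F) {f : Lp ℝ 2 (mj F z)} {w : Rj F z → ℝ}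
    (hw : w ∈ flatJ F z) :
    liftJ hF f =ᵐ[volume] w ∘ darnTo F z ↔ f =ᵐ[mj F z] w :=
  L2Form.compMeasurePreserving_ae_iff _ (continuous_of_mem_flatJ hF hw).aestronglyMeasurable

theorem liftJ_mem_dom_iff (hF : MeasurableSet F) (f : Lp ℝ 2 (mj F z)) :
    f ∈ (flatFormJ F z).dom ↔ liftJ hF f ∈ (flatForm F).dom := by
  constructor
  · rintro ⟨w, hw, hfw⟩
    exact ⟨_, hw, (liftJ_ae_eq_iff hF hw).2 hfw⟩
  · rintro ⟨u, hu, hfu⟩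
    obtain ⟨w, rfl, -⟩ := existsUnique_comp_darnTo (z := z) hF hu
    exact ⟨w, hu, (liftJ_ae_eq_iff hF hu).1 hfu⟩

/-- Composition with `j` need not be onto L²(ℝ), but functions flat off `F` are constant on the
fibres and so factor through `j`. -/
theorem exists_liftJ_eq (hF : MeasurableSet F) {f : Lp ℝ 2 (volume : Measure ℝ)}
    (hf : f ∈ (flatForm F).dom) : ∃ g : Lp ℝ 2 (mj F z), liftJ hF g = f := by
  obtain ⟨u, hu, hfu⟩ := hf
  obtain ⟨w, rfl, -⟩ := existsUnique_comp_darnTo (z := z) hF hu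
  have h : MemLp w 2 (mj F z) :=
    (memLp_map_measure_iff (continuous_of_mem_flatJ hF hu).aestronglyMeasurable
      (continuous_darnTo hF).measurable.aemeasurable).2 ((memLp_congr_ae hfu).1 (Lp.memLp f))
  refine ⟨h.toLp w, Lp.ext ?_⟩
  exact ((liftJ_ae_eq_iff hF hu).2 h.coeFn_toLp).trans hfu.symm

theorem flatFormJ_form (hF : MeasurableSet F) {f g : Lp ℝ 2 (mj F z)}
    (hf : f ∈ (flatFormJ F z).dom) (hg : g ∈ (flatFormJ F z).dom) :
    (flatFormJ F z).form f g = (flatForm F).form (liftJ hF f) (liftJ hF g) := by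
  have := isOpenPosMeasure_mj (z := z) hF
  obtain ⟨w, hw, hfw⟩ := hf
  obtain ⟨v, hv, hgv⟩ := hg
  rw [flatForm_form hw hv ((liftJ_ae_eq_iff hF hw).2 hfw) ((liftJ_ae_eq_iff hF hv).2 hgv)]
  exact L2Form.ofFunctions_form (fun u hu v hv h => ((continuous_of_mem_flatJ hF hu).ae_eq_iff_eq _
    (continuous_of_mem_flatJ hF hv)).1 h) hw hv hfw hgv

theorem isDSpace_flatFormJ (hF : MeasurableSet F) : (flatFormJ F z).IsDSpace :=
  isDSpace_flatForm.pullback (liftJ hF) (fun _ hf => exists_liftJ_eq hF hf)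
    (liftJ_mem_dom_iff hF) (fun _ hf _ hg => flatFormJ_form hF hf hg)
    (L2Form.compMeasurePreserving_compLp (measurePreserving_darnTo hF))

theorem equivalent_flatForm (hF : MeasurableSet F) : (flatForm F).Equivalent (flatFormJ F z) :=
  L2Form.Equivalent.of_measurePreserving (measurePreserving_darnTo hF) isDSpace_flatForm
    (fun _ hf => exists_liftJ_eq hF hf) (liftJ_mem_dom_iff hF)
    (fun _ hf _ hg => flatFormJ_form hF hf hg) (fun _ hf _ hg => flatForm_mul_mem hf hg)

/-! ### Regularity -/

/-- The form on `L²` of the interior of `ℝ_j`. -/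
abbrev interiorForm (F : Set ℝ) (z : ℝ) :
    L2Form ((mj F z).comap (Subtype.val : interiorIn (Rj F z) → Rj F z)) :=
  (flatFormJ F z).restrictTo (measurableSet_interiorIn (Rj F z))

theorem isDSpace_interiorForm (hF : MeasurableSet F) : (interiorForm F z).IsDSpace :=
  (isDSpace_flatFormJ hF).restrictTo _ fun _ hr => mj_singleton_eq_top hF hr

/-- An interior point lies between two values `j p` and `j q`, and the preimage of the interval
between them is contained in the bounded interval `[p, q]`. -/
theorem isLocallyFiniteMeasure_interior (hF : MeasurableSet F) : IsLocallyFiniteMeasure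
    ((mj F z).comap (Subtype.val : interiorIn (Rj F z) → Rj F z)) := by
  refine ⟨fun x => ?_⟩
  obtain ⟨_, ⟨p, rfl⟩, _, ⟨q, rfl⟩, hp, hq⟩ := exists_lt_lt_of_mem_interior x.2
  refine ⟨inclInterior (Rj F z) ⁻¹' Ioo (darn F z p) (darn F z q),
    (isOpenEmbedding_inclInterior _).continuous.continuousAt.preimage_mem_nhds
      (Ioo_mem_nhds hp hq), ?_⟩
  have hsub : Subtype.val '' (inclInterior (Rj F z) ⁻¹' Ioo (darn F z p) (darn F z q)) ⊆
      (Subtype.val : Rj F z → ℝ) ⁻¹' Ioo (darn F z p) (darn F z q) := by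
    rintro _ ⟨r, hr, rfl⟩
    exact hr
  rw [(MeasurableEmbedding.subtype_coe (measurableSet_interiorIn _)).comap_apply]
  refine (measure_mono hsub).trans_lt ?_
  rw [mj, Measure.map_apply (continuous_darnTo hF).measurable
    (measurable_subtype_coe measurableSet_Ioo)]
  refine lt_of_le_of_lt (measure_mono (t := Icc p q) fun t ht => ?_) (by simp)
  exact ⟨((monotone_darn hF).reflect_lt ht.1).le, ((monotone_darn hF).reflect_lt ht.2).le⟩

theorem isOpenPosMeasure_interior (hF : MeasurableSet F) :
    ((mj F z).comap (Subtype.val : interiorIn (Rj F z) → Rj F z)).IsOpenPosMeasure := by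
  have := isOpenPosMeasure_mj (z := z) hF
  refine ⟨fun U hU hne => ?_⟩
  rw [(MeasurableEmbedding.subtype_coe (measurableSet_interiorIn _)).comap_apply]
  exact ((isOpen_interiorIn _).isOpenMap_subtype_val U hU).measure_ne_zero _ (hne.image _)

theorem mem_dom_interiorForm {f : Lp ℝ 2
    ((mj F z).comap (Subtype.val : interiorIn (Rj F z) → Rj F z))} {w : Rj F z → ℝ}
    (hw : w ∈ flatJ F z) (hw0 : ∀ r ∉ interiorIn (Rj F z), w r = 0)
    (hf : f =ᵐ[(mj F z).comap (Subtype.val : interiorIn (Rj F z) → Rj F z)] w ∘ Subtype.val) :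
    f ∈ (interiorForm F z).dom :=
  ⟨w, hw, (L2Form.zeroExt_ae_eq_iff _ hw0).2 hf⟩

theorem restrict_mem_flatJ (hF : MeasurableSet F) {ψ : ℝ → ℝ} (hψ : ContDiff ℝ 1 ψ)
    (hc : HasCompactSupport ψ) (hs : Function.support ψ ⊆ Rj F z) :
    (fun r : Rj F z => ψ r) ∈ flatJ F z := by
  have h : ext0 (fun r : Rj F z => ψ r) = ψ := by
    funext x
    by_cases hx : x ∈ Rj F z
    · exact Subtype.val_injective.extend_apply (fun r : Rj F z => ψ r) 0 ⟨x, hx⟩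
    · rw [ext0, Function.extend_apply' _ _ _ fun ⟨y, hy⟩ => hx (hy ▸ y.2)]
      by_contra h0
      exact hx (hs (Ne.symm h0))
  rw [mem_flatJ_iff hF, h]
  exact ⟨fun a _ b _ => hψ.contDiffOn.absolutelyContinuousOnInterval,
    ((hψ.continuous_deriv le_rfl).memLp_of_hasCompactSupport hc.deriv).restrict _⟩

/-- The extension of `φ` by zero is continuous on ℝ and has a uniformly close C¹ approximation
supported inside its own support. The support condition makes the approximant vanish at the
endpoints and keeps its support compact in the interior. -/
theorem exists_mem_dom_approx (hF : MeasurableSet F) {φ : interiorIn (Rj F z) → ℝ}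
    (hφ : Continuous φ) (hc : HasCompactSupport φ) {ε : ℝ} (hε : 0 < ε) :
    ∃ g ∈ (interiorForm F z).dom, ∃ ψ : interiorIn (Rj F z) → ℝ, Continuous ψ ∧
      Function.support ψ ⊆ Function.support φ ∧
      g =ᵐ[(mj F z).comap (Subtype.val : interiorIn (Rj F z) → Rj F z)] ψ ∧
      ∀ x, |φ x - ψ x| < ε := by
  have := isLocallyFiniteMeasure_interior (z := z) hF
  have he := isOpenEmbedding_inclInterior (Rj F z)
  obtain ⟨ψ, hψ, hclose, hsupp⟩ :=
    (continuous_extend_zero_of_isOpenEmbedding he hφ hc).exists_contDiff_approx 1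
      (continuous_const (y := ε)) fun _ => hε
  have hsub : Function.support ψ ⊆ interior (Rj F z) := fun x hx => by
    rw [← range_inclInterior]
    by_contra h
    exact hsupp hx (Function.extend_apply' _ _ _ h)
  have hsupp' : Function.support (ψ ∘ inclInterior (Rj F z)) ⊆ Function.support φ :=
    fun x hx => by
      have := hsupp (show inclInterior (Rj F z) x ∈ Function.support ψ from hx)
      rwa [Function.mem_support, he.injective.extend_apply] at this
  have hcont : Continuous (ψ ∘ inclInterior (Rj F z)) := hψ.continuous.comp he.continuous
  have hL : MemLp (ψ ∘ inclInterior (Rj F z)) 2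
      ((mj F z).comap (Subtype.val : interiorIn (Rj F z) → Rj F z)) :=
    hcont.memLp_of_hasCompactSupport (hc.mono hsupp')
  refine ⟨hL.toLp _, mem_dom_interiorForm (restrict_mem_flatJ hF hψ
    ((hc.extend_zero he.continuous).mono hsupp) (hsub.trans interior_subset)) (fun r hr => ?_)
    hL.coeFn_toLp, _, hcont, hsupp', hL.coeFn_toLp, fun x => ?_⟩
  · by_contra h
    exact hr (hsub h)
  · have := hclose (inclInterior (Rj F z) x)
    rwa [he.injective.extend_apply, dist_comm, Real.dist_eq] at this

theorem dense_dom_interiorForm (hF : MeasurableSet F) : Dense (interiorForm F z).dom := by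
  have := isLocallyFiniteMeasure_interior (z := z) hF
  have : LocallyCompactSpace (interiorIn (Rj F z)) :=
    (isOpenEmbedding_inclInterior (Rj F z)).locallyCompactSpace
  set ξ := (mj F z).comap (Subtype.val : interiorIn (Rj F z) → Rj F z) with hξ
  intro f
  rw [Metric.mem_closure_iff]
  intro ε hε
  obtain ⟨φ, hc, hφf, hφ, hφL⟩ := (Lp.memLp f).exists_hasCompactSupport_eLpNorm_sub_le
    (by norm_num) (ε := ENNReal.ofReal (ε / 3)) (by simpa using hε)
  set M := ξ (tsupport φ) ^ (1 / (2 : ℝ≥0∞).toReal) with hM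
  have hMtop : M ≠ ∞ := ENNReal.rpow_ne_top_of_nonneg (by simp) hc.measure_lt_top.ne
  -- `M` is the L² norm of the indicator of the support of `φ`, so a uniform error `η` costs at most
  -- `η M ≤ ε / 3`; the `+ 1` covers `M = 0`.
  set η := ε / 3 / (M.toReal + 1) with hη
  have hη0 : 0 < η := by positivity
  have hηM : η * M.toReal ≤ ε / 3 := by
    rw [hη, div_mul_eq_mul_div, div_le_iff₀ (by positivity)]
    nlinarith
  obtain ⟨g, hg, ψ, hψ, hψs, hgψ, hclose⟩ := exists_mem_dom_approx hF hφ hc hη0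
  have h1 : eLpNorm (φ - ψ) 2 ξ ≤ ENNReal.ofReal (ε / 3) := by
    refine (eLpNorm_sub_le_of_dist_bdd ξ (by norm_num) (isClosed_tsupport φ).measurableSet hη0.le
      (fun x => by rw [Real.dist_eq]; exact (hclose x).le) (subset_tsupport φ)
      (hψs.trans (subset_tsupport φ))).trans ?_
    rw [← hM, ← ENNReal.ofReal_toReal hMtop, ← ENNReal.ofReal_mul hη0.le]
    exact ENNReal.ofReal_le_ofReal hηM
  refine ⟨g, hg, ?_⟩
  rw [Lp.dist_def, eLpNorm_congr_ae ((ae_eq_refl _).sub hgψ)]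
  have h2 : eLpNorm ((f : interiorIn (Rj F z) → ℝ) - ψ) 2 ξ ≤ ENNReal.ofReal (2 * ε / 3) := by
    have h3 : (f : interiorIn (Rj F z) → ℝ) - ψ = ((f : _ → ℝ) - φ) + (φ - ψ) := by simp
    rw [h3]
    refine (eLpNorm_add_le ((Lp.aestronglyMeasurable f).sub hφ.aestronglyMeasurable)
      (hφ.aestronglyMeasurable.sub hψ.aestronglyMeasurable) (by norm_num)).trans ?_
    refine (add_le_add hφf h1).trans ?_
    rw [← ENNReal.ofReal_add (by positivity) (by positivity)]
    exact ENNReal.ofReal_le_ofReal (by linarith)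
  have h4 : 2 * ε / 3 < ε := by linarith
  exact (ENNReal.toReal_le_of_le_ofReal (by positivity) h2).trans_lt h4

/-- The set `|u| ≥ δ` of the lift `u` is compact by decay at infinity, hence so is its image under
`j`. The image avoids the endpoints of `ℝ_j`, since `w` vanishes there, and off it the thresholded
function is 0. -/
theorem hasCompactSupport_soft (hF : MeasurableSet F) {w : Rj F z → ℝ} (hw : w ∈ flatJ F z)
    (hw2 : MemLp w 2 (mj F z)) {δ : ℝ} (hδ : 0 < δ) :
    HasCompactSupport (soft δ ∘ w ∘ (Subtype.val : interiorIn (Rj F z) → Rj F z)) := by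
  have hu2 : MemLp (w ∘ darnTo F z) 2 volume :=
    hw2.comp_measurePreserving (measurePreserving_darnTo hF)
  have hdecay := tendsto_cocompact_of_memLp hw.1 hu2
  have hcont := hw.1.1.continuous
  obtain ⟨K, hK, hKs⟩ := mem_cocompact.1 (Metric.tendsto_nhds.1 hdecay δ hδ)
  set L := K ∩ {x | δ ≤ |(w ∘ darnTo F z) x|} with hL
  have hLc : IsCompact L := hK.inter_right (isClosed_le continuous_const hcont.abs)
  have hsub : darn F z '' L ⊆ interior (Rj F z) := by
    rintro _ ⟨x, hx, rfl⟩
    by_contra h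
    have h0 : w (darnTo F z x) = 0 := L2Form.eq_zero_of_memLp_of_measure_singleton hw2
      (mj_singleton_eq_top hF h)
    have := hx.2
    rw [mem_ofPred_eq, Function.comp_apply, h0, abs_zero] at this
    exact this.not_gt hδ
  refine HasCompactSupport.intro (K := inclInterior (Rj F z) ⁻¹' (darn F z '' L)) ?_ fun r hr => ?_
  · refine ((isOpenEmbedding_inclInterior _).isInducing.isCompact_preimage_iff ?_).2
      (hLc.image (continuous_darn hF))
    rwa [range_inclInterior]
  · refine soft_of_abs_le ?_
    obtain ⟨⟨_, x, rfl⟩, hx⟩ := r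
    by_contra h
    have h' : δ < |(w ∘ darnTo F z) x| := not_le.1 h
    refine hr ⟨x, ⟨?_, h'.le⟩, rfl⟩
    by_contra hxK
    have := hKs hxK
    rw [mem_ofPred_eq, dist_zero_right, Real.norm_eq_abs] at this
    exact this.not_gt h'

theorem sq1_interiorForm (hF : MeasurableSet F) {f : Lp ℝ 2
    ((mj F z).comap (Subtype.val : interiorIn (Rj F z) → Rj F z))}
    (hf : f ∈ (interiorForm F z).dom) : (interiorForm F z).sq1 f =
      (flatForm F).sq1 (liftJ hF (L2Form.zeroExtₗᵢ (measurableSet_interiorIn (Rj F z)) f)) := by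
  rw [L2Form.sq1, L2Form.sq1, LinearIsometry.norm_map, LinearIsometry.norm_map]
  congr 1
  exact flatFormJ_form hF hf hf

theorem isRegularDirichlet_interiorForm (hF : MeasurableSet F) :
    (interiorForm F z).IsRegularDirichlet where
  locallyCompact := (isOpenEmbedding_inclInterior (Rj F z)).locallyCompactSpace
  separable := inferInstance
  metrizable := inferInstance
  radon := by
    have := isLocallyFiniteMeasure_interior (z := z) hF
    infer_instance
  fullSupport := isOpenPosMeasure_interior hF
  isDSpace := isDSpace_interiorForm hF
  dense := dense_dom_interiorForm hF
  dense_dom := by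
    intro f hf ε hε
    have hD := isDSpace_interiorForm (z := z) hF
    have hUm := measurableSet_interiorIn (Rj F z)
    -- The estimate is made on ℝ and carried back: thresholding commutes with both extension by zero
    -- and composition with `j`.
    obtain ⟨δ, hδ, hlt⟩ := exists_sq1_sub_soft_lt
      ((liftJ_mem_dom_iff hF (L2Form.zeroExtₗᵢ hUm f)).1 hf) hε
    have hg := (hD.markov _ (lipschitzWith_soft δ) (soft_zero hδ.le) f hf).1
    refine ⟨(lipschitzWith_soft δ).compLp (soft_zero hδ.le) f, hg, ?_, ?_⟩
    · obtain ⟨w, hw, hfw⟩ := hf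
      have hw2 : MemLp w 2 (mj F z) := (memLp_congr_ae hfw).1 (Lp.memLp _)
      have hw0 : ∀ r ∉ interiorIn (Rj F z), w r = 0 := fun r hr =>
        L2Form.eq_zero_of_memLp_of_measure_singleton hw2 (mj_singleton_eq_top hF hr)
      refine ⟨_, ?_, hasCompactSupport_soft hF hw hw2 hδ, ?_⟩
      · exact (lipschitzWith_soft δ).continuous.comp
          ((continuous_of_mem_flatJ hF hw).comp continuous_subtype_val)
      · filter_upwards [(lipschitzWith_soft δ).coeFn_compLp (soft_zero hδ.le) f,
          (L2Form.zeroExt_ae_eq_iff hUm hw0).1 hfw] with x h1 h2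
        rw [h1, Function.comp_apply, h2]
        rfl
    · rw [sq1_interiorForm hF (hD.sub_mem hf hg), map_sub, map_sub]
      convert hlt using 3
      rw [liftJ, ← L2Form.compMeasurePreserving_compLp]
      exact congrArg _ (L2Form.zeroExt_compLp hUm _ _ _ f)
  dense_Cc := by
    intro φ hφ hc ε hε
    obtain ⟨g, hg, ψ, h1, h2, h3, h4⟩ := exists_mem_dom_approx hF hφ hc hε
    exact ⟨g, hg, ψ, h1, hc.mono h2, h3, h4⟩

theorem isRegularDirichletOnInterval_flatFormJ (hF : MeasurableSet F) :
    IsRegularDirichletOnInterval (flatFormJ F z) :=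
  ⟨ordConnected_Rj hF, fun _ hr => mj_singleton_eq_top hF hr, isDSpace_flatFormJ hF,
    isRegularDirichlet_interiorForm hF⟩

end Darning

end

/-! ### The theorem, deduced from `Gs s = flatOff F`. -/

theorem theorem3p6
    -- a scaling function `s`, i.e. strictly increasing, absolutely continuous, `s' ∈ {0, 1}` a.e.
    (s : ℝ → ℝ) (hs : StrictMono s) (hac : Darning.AbsContOn Set.univ s)
    (hderiv : ∀ᵐ x, deriv s x = 0 ∨ deriv s x = 1)
    -- `G` is an open version of `{s' = 1}`, and `F = Gᶜ`
    (G : Set ℝ) (hGopen : IsOpen G) (hG : G =ᵐ[volume] {x | deriv s x = 1})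
    (F : Set ℝ) (hF : F = Gᶜ) (hFpos : 0 < volume F) (hFiso : Preperfect F)
    (hGinf : volume G = ∞)
    (z : ℝ) (hz : z ∈ F \ Darning.endpoints G) :
    -- each closed component of `G` is collapsed to a point by `j`
    (∀ x ∈ G, ∀ p ∈ closure (connectedComponentIn G x),
      ∀ q ∈ closure (connectedComponentIn G x), Darning.darn F z p = Darning.darn F z q) ∧
    -- and nothing else is identified if `F` has positive measure near each of its points
    ((∀ x ∈ F, ∀ ε > 0, 0 < volume (F ∩ Ioo (x - ε) (x + ε))) →
      ∀ p q, Darning.darn F z p = Darning.darn F z q →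
        p = q ∨ ∃ x ∈ G, p ∈ closure (connectedComponentIn G x) ∧
          q ∈ closure (connectedComponentIn G x)) ∧
    -- each `u ∈ 𝒢^(s)` determines a unique `û` on `ℝ_j` with `û ∘ j = u`
    (∀ u ∈ Darning.Gs s, ∃! w : Darning.Rj F z → ℝ, w ∘ Darning.darnTo F z = u) ∧
    -- the range of `u ↦ û`
    Darning.Gsj s F z =
      {w | Darning.AbsContOn (Darning.Rj F z) (Darning.ext0 w) ∧
        MemLp (deriv (Darning.ext0 w)) 2 (volume.restrict (Darning.Rj F z))} ∧
    -- the form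
    (∀ f ∈ Darning.Gsj s F z, ∀ g ∈ Darning.Gsj s F z,
      Darning.energyJ F z f g =
        (1 / 2) * ∫ x in Darning.Rj F z,
          deriv (Darning.ext0 f) x * deriv (Darning.ext0 g) x) ∧
    -- regular Dirichlet form, regular representation
    Darning.IsRegularDirichletOnInterval (Darning.formGj0 s F z) ∧
    Darning.IsRegularRepresentation (Darning.formG0 s) (Darning.formGj0 s F z) := by
  open Darning in
  have hGm := hGopen.measurableSet
  have hFm : MeasurableSet F := hF ▸ hGm.compl
  have hds := dsMeasure_eq_restrict hs.monotone hac hderiv hGm hG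
  have hGs : Gs s = flatOff F := by
    ext u
    rw [mem_Gs_iff hds hGm hGinf, flatOff, mem_ofPred_eq, hF]
    simp only [notMem_compl_iff]
  have hGsj : Gsj s F z = flatJ F z := by
    ext w
    rw [Gsj_eq hFm hGs, mem_flatJ_iff hFm]
    rfl
  have hform : formG0 s = flatForm F := by rw [formG0, flatForm, hGs]
  have hformJ : formGj0 s F z = flatFormJ F z := by rw [formGj0, flatFormJ, hGsj]
  refine ⟨fun x _ p hp q hq => ?_, fun hpos p q hpq => ?_, fun u hu => ?_, Gsj_eq hFm hGs,
    fun f hf g hg => ?_, ?_, ?_, ?_⟩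
  · refine darn_eq_of_mem_closure hFm isPreconnected_connectedComponentIn ?_ hp hq
    rw [hF]
    exact disjoint_compl_right.mono_left (connectedComponentIn_subset G x)
  · rcases lt_trichotomy p q with h | h | h
    · exact Or.inr (mem_closure_component_of_darn_eq hFm hF hpos h hpq)
    · exact Or.inl h
    · obtain ⟨x, hx, h1, h2⟩ := mem_closure_component_of_darn_eq hFm hF hpos h hpq.symm
      exact Or.inr ⟨x, hx, h2, h1⟩
  · exact existsUnique_comp_darnTo hFm (hGs ▸ hu)
  · rw [Gsj_eq hFm hGs] at hf hg
    rw [← energy_comp_darn hFm hf.1 hg.1, ext0_comp_darn, ext0_comp_darn, energyJ]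
  · rw [hformJ]
    exact isRegularDirichletOnInterval_flatFormJ hFm
  · rw [hform, hformJ]
    exact equivalent_flatForm hFm
  · rw [hformJ]
    exact isRegularDirichletOnInterval_flatFormJ hFm
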